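/- **Conventions.** Let $\alpha\in(0,1)$ be irrational, $\alpha=[0;a_1,a_2,\dots]$, with $q_{-1}=0$, $q_0=1$, $q_{n+1}=a_{n+1}q_n+q_{n-1}$, and let $s_{-1}=1$, $s_0=0$, $s_1=s_0^{a_1-1}s_{-1}$, $s_{n+1}=s_n^{a_{n+1}}s_{n-1}$ $(n\ge1)$ be the standard words; $\widetilde u$ is the reversal of $u$ and $T$ the shift. A word $x\in\{0,1\}^{\mathbb N}$ is sturmian if it has exactly $n+1$ factors of each length $n\ge 1$; its slope is the limit of $|u|_1/|u|$ over its factors $u$ as $|u|\to\infty$. The characteristic word $c_\alpha$ is the infinite word whose prefixes are the left special factors of the sturmian words of slope $\alpha$. An $\alpha$-number is a sequence $\rho=(\rho_n)_{n\ge 0}$ of integers with $0\le\rho_n<q_n$ and $\rho_n\equiv\rho_{n+1}\pmod{q_n}$; it is written $\rho=\sum_{i\ge0}b_{i+1}q_i$, where $\rho_{n+1}=b_{n+1}q_n+\rho_n$. Put $T^\rho(c_\alpha)=\lim_n T^{\rho_n}(c_\alpha)$. If $x=T^\rho(c_\alpha)$, then $\rho$ is called the formal intercept of $x$; $\rho+k$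 denotes the formal intercept of $T^k(T^\rho(c_\alpha))$. Two $\alpha$-numbers $\rho,\gamma$ are equivalent if $\rho+k=\gamma+l$ for some integers $k,l\ge0$; $\rho$ has non-zero equivalence class if it is not equivalent to $0$. A sturmian word of slope $\alpha$ has non-zero equivalence class if it has no formal intercept equivalent to $0$. For $\rho$ with non-zero equivalence class, let $\widetilde{\mathbb P}_\rho(c_\alpha)=\prod_{i=0}^{\infty}\widetilde{s_i}^{\,b_{i+1}}$ (an infinite word), let $\Lambda_\rho(n)=\min\{m\ge n : b_{m+1}\ne0\}$, and let $\Psi_n$ map an integer $k\ge 0$ to the integer in $[0,q_n)$ obtained from $k<q_m$ (with $m\ge n$) by reducing successively modulo $q_{m-1},q_{m-2},\dots,q_n$. The complement $\overline\rho$ of $\rho$ is the $\alpha$-number with $$\overline\rho_n=\Psi_n\bigl(q_{\Lambda_\rho(n)+1}-2-\rho_{\Lambda_\rho(n)+1}\bigr)\quad\text{for all sufficiently large } n .$$ **Theorem.** (1) For every $\alpha$-number $\rho$ with non-zero equivalence class, the complement $\overline\rho$ exists (and is unique), the limit defining $T^\rho(c_\alpha)$ exists, and the product defining $\widetilde{\mathbb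 P}_{\overline\rho}(c_\alpha)$ is an infinite word. The map $\rho\mapsto\overline\rho$ is an involution of the set of $\alpha$-numbers with non-zero equivalence class (that is, $\overline\rho$ again has non-zero equivalence class and $\overline{\overline\rho}=\rho$), and $$T^\rho(c_\alpha)=\widetilde{\mathbb P}_{\overline\rho}(c_\alpha).$$ Moreover, the bi-infinite word $\widetilde{T^{\overline\rho}(c_\alpha)}\cdot T^\rho(c_\alpha)$ is a sturmian orbit of slope $\alpha$, i.e. all its right-infinite tails are sturmian words of slope $\alpha$. (2) For every sturmian word $x$ of slope $\alpha$ with non-zero equivalence class there exists a unique $\alpha$-number $\rho$ with non-zero equivalence class such that $x=\widetilde{\mathbb P}_\rho(c_\alpha)$. -/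

import Mathlib

open Filter Topology

namespace Sturm

/-! ### Infinite words over the alphabet {0, 1} (`false` is the letter 0, `true` is the letter 1) -/

/-- One-sided infinite words. The letter `x_{n+1}` of the usual notation `x = x_1 x_2 x_3 ...` is
`x n`. The topology is the product of the discrete topologies. -/
abbrev Word : Type := ℕ → Bool

/-- The shift operator `T`. -/
def shift (x : Word) : Word := fun n => x (n + 1)

/-- The factor of `x` of length `n` that starts at position `i`. -/
def factorAt (x : Word) (i n : ℕ) : List Bool := (List.range n).map fun j => x (i + j)

/-- The finite word `u` is a factor of `x`. -/
def IsFactor (u : List Bool) (x : Word) : Prop := ∃ i, u = factorAt x i u.length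

/-- The prefix of `x` of length `n`. -/
def wordPrefix (x : Word) (n : ℕ) : List Bool := factorAt x 0 n

/-- The complexity function: the number of factors of length `n`. -/
noncomputable def complexity (x : Word) (n : ℕ) : ℕ :=
  Set.ncard {u : List Bool | u.length = n ∧ IsFactor u x}

/-- Sturmian words. -/
def IsSturmian (x : Word) : Prop := ∀ n, 1 ≤ n → complexity x n = n + 1

/-- The frequency of the letter 1 in the factors `u` of `x` tends to `α` as `|u| → ∞`. -/
def HasSlope (x : Word) (α : ℝ) : Prop :=
  ∀ ε : ℝ, 0 < ε → ∃ N : ℕ, ∀ u : List Bool, IsFactor u x → N ≤ u.length →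
    |(u.count true : ℝ) / (u.length : ℝ) - α| < ε

/-- Sturmian words of slope `α`. -/
def IsSturmianOfSlope (α : ℝ) (x : Word) : Prop := IsSturmian x ∧ HasSlope x α

/-- `u` is a left special factor of `x`: both `0u` and `1u` are factors of `x`. -/
def IsLeftSpecial (x : Word) (u : List Bool) : Prop :=
  IsFactor (false :: u) x ∧ IsFactor (true :: u) x

/-- `c` is the limit of the left special factors of a sturmian word of slope `α`. -/
def IsCharacteristic (α : ℝ) (c : Word) : Prop :=
  ∃ x : Word, IsSturmianOfSlope α x ∧ ∀ n, 1 ≤ n → IsLeftSpecial x (wordPrefix c n)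

/-- The characteristic word `c_α`; for a slope `α` it is the only word with
`IsCharacteristic α c`. -/
noncomputable def characteristicWord (α : ℝ) : Word := Classical.epsilon (IsCharacteristic α)

/-! ### Bi-infinite words -/

/-- The bi-infinite word `ỹ · x = ... y_3 y_2 y_1 · x_1 x_2 x_3 ...`. -/
def biInfinite (y x : Word) : ℤ → Bool
  | Int.ofNat n => x n
  | Int.negSucc n => y n

/-- A sturmian orbit of slope `α`: a bi-infinite word all of whose right-infinite tails are
sturmian words of slope `α`. -/
def IsSturmianOrbit (α : ℝ) (w : ℤ → Bool) : Prop :=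
  ∀ k : ℤ, IsSturmianOfSlope α fun n : ℕ => w (k + n)

/-! ### Continued fraction, continuants, standard words -/

/-- The partial quotients `a_n` of `α = [0; a_1, a_2, ...]`, for `n ≥ 1`. The default value 1 plays
no role when `α` is irrational, as the expansion is then infinite. -/
noncomputable def partQuot (α : ℝ) : ℕ → ℕ
  | 0 => 0
  | n + 1 => ⌊((GenContFract.of α).partDens.get? n).getD 1⌋₊

/-- The continuants `q_n` for `n ≥ 0`; the value `q_{-1} = 0` is built into `q_1 = a_1`. -/
noncomputable def continuant (α : ℝ) : ℕ → ℕ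
  | 0 => 1
  | 1 => partQuot α 1
  | n + 2 => partQuot α (n + 2) * continuant α (n + 1) + continuant α n

/-- The standard words `s_n` for `n ≥ 0`; the word `s_{-1} = 1` is built into `s_1`. -/
noncomputable def standardWord (α : ℝ) : ℕ → List Bool
  | 0 => [false]
  | 1 => List.replicate (partQuot α 1 - 1) false ++ [true]
  | n + 2 =>
    (List.replicate (partQuot α (n + 2)) (standardWord α (n + 1))).flatten ++ standardWord α n

theorem partQuot_pos (α : ℝ) (n : ℕ) : 0 < partQuot α (n + 1) := by
  rw [partQuot, Nat.floor_pos]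
  cases h : (GenContFract.of α).partDens.get? n with
  | none => simp
  | some b => simpa using GenContFract.of_one_le_get?_partDen h

theorem continuant_pos (α : ℝ) (n : ℕ) : 0 < continuant α n := by
  induction n using Nat.strong_induction_on with
  | _ n ih =>
    match n with
    | 0 => simp [continuant]
    | 1 => simpa [continuant] using partQuot_pos α 0
    | m + 2 =>
      rw [continuant]
      exact Nat.add_pos_right _ (ih m (by omega))

/-! ### α-numbers -/

/-- The `α`-numbers: sequences `(ρ_n)` with `0 ≤ ρ_n < q_n` and `ρ_n ≡ ρ_{n+1}` modulo `q_n`. The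
component of index 0 is forced to be 0, as `q_0 = 1`. -/
@[ext]
structure AlphaNumber (α : ℝ) where
  comp : ℕ → ℕ
  lt : ∀ n, comp n < continuant α n
  compat : ∀ n, comp n ≡ comp (n + 1) [MOD continuant α n]

/-- The zero `α`-number. -/
instance (α : ℝ) : Zero (AlphaNumber α) :=
  ⟨⟨fun _ => 0, fun n => continuant_pos α n, fun _ => rfl⟩⟩

instance (α : ℝ) : Nonempty (AlphaNumber α) := ⟨0⟩

variable {α : ℝ}

/-- The Ostrowski digit `b_{i+1}` of `ρ = ∑ b_{i+1} q_i`: as `ρ_i < q_i`, it is the quotient of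
`ρ_{i+1} = b_{i+1} q_i + ρ_i` by `q_i`. -/
noncomputable def AlphaNumber.digit (ρ : AlphaNumber α) (i : ℕ) : ℕ :=
  ρ.comp (i + 1) / continuant α i

theorem AlphaNumber.comp_succ (ρ : AlphaNumber α) (n : ℕ) :
    ρ.comp (n + 1) = ρ.digit n * continuant α n + ρ.comp n := by
  have h := ρ.compat n
  rw [Nat.ModEq, Nat.mod_eq_of_lt (ρ.lt n)] at h
  rw [h, AlphaNumber.digit, mul_comm]
  exact (Nat.div_add_mod _ _).symm

/-- The word `T^ρ(c_α) = lim T^{ρ_n}(c_α)` of formal intercept `ρ`. -/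
noncomputable def AlphaNumber.word (ρ : AlphaNumber α) : Word :=
  limUnder atTop fun n => shift^[ρ.comp n] (characteristicWord α)

/-- `ρ + k = σ`, that is, `σ` is a formal intercept of `T^k(T^ρ(c_α))`. -/
def AlphaNumber.IsAdd (ρ : AlphaNumber α) (k : ℕ) (σ : AlphaNumber α) : Prop :=
  σ.word = shift^[k] ρ.word

/-- Equivalence of `α`-numbers: `ρ + k = γ + l` for some `k, l ≥ 0`. -/
def AlphaNumber.Equivalent (ρ γ : AlphaNumber α) : Prop :=
  ∃ (k l : ℕ) (σ : AlphaNumber α), ρ.IsAdd k σ ∧ γ.IsAdd l σ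

/-- `ρ` has non-zero equivalence class. -/
def AlphaNumber.NonzeroClass (ρ : AlphaNumber α) : Prop := ¬ ρ.Equivalent 0

/-- The sturmian word `x` of slope `α` has zero equivalence class: it has a formal intercept that is
equivalent to 0. -/
def WordHasZeroClass (α : ℝ) (x : Word) : Prop :=
  ∃ ρ : AlphaNumber α, x = ρ.word ∧ ρ.Equivalent 0

/-! ### Infinite products and complements -/

/-- The finite product `s̃_0^{b_1} s̃_1^{b_2} ⋯ s̃_{N-1}^{b_N}` of reversed standard words. -/
noncomputable def AlphaNumber.finProd (ρ : AlphaNumber α) : ℕ → List Bool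
  | 0 => []
  | N + 1 => ρ.finProd N ++ (List.replicate (ρ.digit N) (standardWord α N).reverse).flatten

/-- The finite products are prefixes of one another. -/
theorem AlphaNumber.finProd_prefix (ρ : AlphaNumber α) (N : ℕ) :
    ρ.finProd N <+: ρ.finProd (N + 1) :=
  List.prefix_append _ _

open Classical in
/-- The infinite product `P̃_ρ(c_α) = ∏_{i ≥ 0} s̃_i^{b_{i+1}}`, for `ρ` not a natural integer: the
letter at position `i` is read off in the first finite product that is long enough. -/
noncomputable def AlphaNumber.infProd (ρ : AlphaNumber α) : Word := fun i =>
  if h : ∃ N, i < (ρ.finProd N).length then (ρ.finProd (Nat.find h))[i]'(Nat.find_spec h)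
  else false

/-- The support of `ρ`. -/
def AlphaNumber.supp (ρ : AlphaNumber α) : Set ℕ := {n | ρ.digit n ≠ 0}

/-- `Λ_ρ(n) = min (Supp(ρ) ∩ [n, ∞))`, for `ρ` not a natural integer. -/
noncomputable def AlphaNumber.nextSupp (ρ : AlphaNumber α) (n : ℕ) : ℕ :=
  sInf (ρ.supp ∩ Set.Ici n)

/-- `psi α n d` is the map `Ψ_n^{n+d} : [0, q_{n+d}) → [0, q_n)`, the composition of the reductions
modulo `q_{n+d-1}`, then modulo `q_{n+d-2}`, and so on down to modulo `q_n`. -/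
noncomputable def psi (α : ℝ) (n : ℕ) : ℕ → ℕ → ℕ
  | 0, k => k
  | d + 1, k => psi α n d (k % continuant α (n + d))

/-- The sequence `n ↦ Ψ_n(q_{Λ(n)+1} - 2 - ρ_{Λ(n)+1})` where `Λ = Λ_ρ`. -/
noncomputable def AlphaNumber.complSeq (ρ : AlphaNumber α) (n : ℕ) : ℕ :=
  psi α n (ρ.nextSupp n + 1 - n)
    (continuant α (ρ.nextSupp n + 1) - 2 - ρ.comp (ρ.nextSupp n + 1))

/-- `σ` is asymptotically given by the sequence `complSeq ρ`. -/
def AlphaNumber.IsComplement (ρ σ : AlphaNumber α) : Prop :=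
  ∀ᶠ n in atTop, σ.comp n = ρ.complSeq n

/-- The complement `ρ̄`: the `α`-number asymptotically given by the sequence `complSeq ρ` (there is
at most one, since `σ_n` determines `σ_m` for `m ≤ n`). -/
noncomputable def AlphaNumber.complement (ρ : AlphaNumber α) : AlphaNumber α :=
  Classical.epsilon ρ.IsComplement

end Sturm

open Sturm

namespace Sturm
variable {α : ℝ}

/-! ### Continued fractions -/

/-! Everything is transported to the rotation by `α` on `ℝ/ℤ`. An `α`-number `ρ` with digits
`b_{i+1}` has an angle `β = ∑ b_{i+1} (q_i α - p_i)`, the limit of `ρ_n α` modulo integers. The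
characteristic word codes the orbit of `α`: its letter `n` is `letter α ((n + 1) α)`. Hence the
letter `i` of `T^ρ(c_α)` codes `β + (i + 1) α`. The finite products of reversed standard words are
the reversed prefixes of `c_α` of lengths `ρ_N`, so the letter `i` of the infinite product codes `β
- i α`. Both formulas hold when `β` is not in `ℤ α + ℤ`, and this condition characterises the
non-zero classes (`AlphaNumber.nonzeroClass_iff`).

The complement is built so that `ρ_n + ρ̄_n + 2` is eventually `q_n`, `q_{n-1}` or `q_n + q_{n-1}`;
multiples of `α` by these are nearly integers. In the limit the angle of `ρ̄` is `-β - 2α` modulo 1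
(`AlphaNumber.IsComplement.angle_add`). The coding is invariant under `t ↦ -t - α` off the
discontinuities (`letter_reflect`), and this reflection turns the forward coding from `β` into the
backward coding from `-β - 2α`. This gives the product formula and the bi-infinite orbit. Doing it
twice restores the angle modulo 1, and uniqueness of Ostrowski expansions
(`AlphaNumber.eq_of_angle_sub_int`) gives the involution.

For (2), every sturmian word of slope `α` must have a formal intercept. Sturmian words are balanced,
hence of low discrepancy. A count shows that all words of low discrepancy have the same factors, so
each prefix is a factor of `c_α`, and compactness yields the intercept. Its complement gives the
product, and uniqueness again comes from the angle. -/

/-- The orbit of `α` under the Gauss map. -/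
noncomputable def gaussOrbit (α : ℝ) : ℕ → ℝ
  | 0 => α
  | n + 1 => Int.fract (gaussOrbit α n)⁻¹

theorem gaussOrbit_irrational (hα : Irrational α) (n : ℕ) : Irrational (gaussOrbit α n) := by
  induction n with
  | zero => exact hα
  | succ n ih =>
    have h : Irrational (gaussOrbit α n)⁻¹ := ih.inv
    rw [gaussOrbit, Int.fract]
    exact_mod_cast h.sub_intCast ⌊(gaussOrbit α n)⁻¹⌋

theorem gaussOrbit_pos (hα : Irrational α) (h0 : 0 < α) (n : ℕ) : 0 < gaussOrbit α n := by
  cases n with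
  | zero => exact h0
  | succ n =>
    exact lt_of_le_of_ne (Int.fract_nonneg _) (gaussOrbit_irrational hα (n + 1)).ne_zero.symm

theorem gaussOrbit_lt_one (h1 : α < 1) (n : ℕ) : gaussOrbit α n < 1 := by
  cases n with
  | zero => exact h1
  | succ n => exact Int.fract_lt_one _

/-- Irrationality keeps Mathlib's continued fraction stream from terminating, so its fractional
parts can be identified with the Gauss orbit. -/
theorem stream_fr (hα : Irrational α) (h0 : 0 < α) (h1 : α < 1) (n : ℕ) :
    ∃ p, GenContFract.IntFractPair.stream α n = some p ∧ p.fr = gaussOrbit α n := by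
  induction n with
  | zero =>
    refine ⟨_, GenContFract.IntFractPair.stream_zero α, ?_⟩
    simp only [GenContFract.IntFractPair.of, gaussOrbit]
    exact Int.fract_eq_self.2 ⟨h0.le, h1⟩
  | succ n ih =>
    obtain ⟨p, hp, hfr⟩ := ih
    refine ⟨_, GenContFract.IntFractPair.stream_succ_of_some hp
      (hfr ▸ (gaussOrbit_pos hα h0 n).ne'), ?_⟩
    simp [GenContFract.IntFractPair.of, gaussOrbit, hfr]

theorem partQuot_succ (hα : Irrational α) (h0 : 0 < α) (h1 : α < 1) (n : ℕ) :
    (partQuot α (n + 1) : ℤ) = ⌊(gaussOrbit α n)⁻¹⌋ := by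
  obtain ⟨p, hp, hfr⟩ := stream_fr hα h0 h1 n
  have h := GenContFract.IntFractPair.stream_succ_of_some hp
      (hfr ▸ (gaussOrbit_pos hα h0 n).ne')
  have h2 := GenContFract.get?_of_eq_some_of_succ_get?_intFractPair_stream h
  have h3 := GenContFract.partDen_eq_s_b h2
  rw [partQuot, h3]
  simp only [GenContFract.IntFractPair.of, Option.getD_some, hfr]
  have h4 : 0 ≤ ⌊(gaussOrbit α n)⁻¹⌋ :=
    Int.floor_nonneg.2 (inv_nonneg.2 (gaussOrbit_pos hα h0 n).le)
  lift ⌊(gaussOrbit α n)⁻¹⌋ to ℕ using h4 with k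
  simp

theorem gaussOrbit_inv (hα : Irrational α) (h0 : 0 < α) (h1 : α < 1) (n : ℕ) :
    (gaussOrbit α n)⁻¹ = partQuot α (n + 1) + gaussOrbit α (n + 1) := by
  have := partQuot_succ hα h0 h1 n
  have h2 : (partQuot α (n + 1) : ℝ) = (⌊(gaussOrbit α n)⁻¹⌋ : ℝ) := by exact_mod_cast this
  rw [h2, gaussOrbit]
  exact (Int.floor_add_fract _).symm

/-- The numerators `p_n` of the convergents. -/
noncomputable def convNum (α : ℝ) : ℕ → ℕ
  | 0 => 0
  | 1 => 1
  | n + 2 => partQuot α (n + 2) * convNum α (n + 1) + convNum α n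

/-- `gap α (n + 1) = |q_n α - p_n|` and `gap α 0 = 1`. -/
noncomputable def gap (α : ℝ) (n : ℕ) : ℝ := ∏ i ∈ Finset.range n, gaussOrbit α i

theorem gap_pos (hα : Irrational α) (h0 : 0 < α) (n : ℕ) : 0 < gap α n :=
  Finset.prod_pos fun i _ => gaussOrbit_pos hα h0 i

theorem gap_zero : gap α 0 = 1 := by simp [gap]

theorem gap_one : gap α 1 = α := by simp [gap, gaussOrbit]

theorem gap_rec (hα : Irrational α) (h0 : 0 < α) (h1 : α < 1) (n : ℕ) :
    gap α n = partQuot α (n + 1) * gap α (n + 1) + gap α (n + 2) := by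
  have h := gaussOrbit_inv hα h0 h1 n
  have hp := (gaussOrbit_pos hα h0 n).ne'
  have e : gaussOrbit α (n + 1) = (gaussOrbit α n)⁻¹ - partQuot α (n + 1) := by linarith
  rw [gap, gap, gap, Finset.prod_range_succ, Finset.prod_range_succ, Finset.prod_range_succ, e]
  field_simp
  ring

theorem gap_succ_lt (hα : Irrational α) (h0 : 0 < α) (h1 : α < 1) (n : ℕ) :
    gap α (n + 1) < gap α n := by
  rw [gap, Finset.prod_range_succ]
  exact mul_lt_of_lt_one_right (gap_pos hα h0 n) (gaussOrbit_lt_one h1 n)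

theorem gap_add_le (hα : Irrational α) (h0 : 0 < α) (h1 : α < 1) (n : ℕ) :
    gap α (n + 1) + gap α (n + 2) ≤ gap α n := by
  rw [gap_rec hα h0 h1 n]
  have h : (1 : ℝ) ≤ partQuot α (n + 1) := by exact_mod_cast partQuot_pos α n
  nlinarith [gap_pos hα h0 (n + 1)]

theorem gap_anti (hα : Irrational α) (h0 : 0 < α) (h1 : α < 1) : Antitone (gap α) :=
  antitone_nat_of_succ_le fun n => (gap_succ_lt hα h0 h1 n).le

/-- The signed errors obey the recurrence of `continuant` and `convNum`, their absolute values that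
of `gap`; the signs alternate. -/
theorem convergent_sub (hα : Irrational α) (h0 : 0 < α) (h1 : α < 1) (n : ℕ) :
    continuant α n * α - convNum α n = (-1) ^ n * gap α (n + 1) := by
  induction n using Nat.strong_induction_on with
  | _ n ih =>
    match n with
    | 0 => simp [continuant, convNum, gap_one]
    | 1 =>
      have := gap_rec hα h0 h1 0
      rw [gap_zero, gap_one] at this
      simp only [continuant, convNum]
      push_cast
      simp only [zero_add] at this ⊢
      linarith
    | m + 2 =>
      have ha := ih m (by omega)
      have hb := ih (m + 1) (by omega)
      have := gap_rec hα h0 h1 (m + 1)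
      simp only [continuant, convNum]
      push_cast
      rw [pow_succ] at hb
      rw [pow_add]
      have e : gap α (m + 2 + 1) = gap α (m + 1) - partQuot α (m + 2) * gap α (m + 1 + 1) := by
        linarith
      rw [e]
      linear_combination (partQuot α (m + 2) : ℝ) * hb + ha

theorem det_convergents (α : ℝ) (n : ℕ) :
    (convNum α (n + 1) : ℤ) * continuant α n - convNum α n * continuant α (n + 1) = (-1) ^ n := by
  induction n with
  | zero => simp [continuant, convNum]
  | succ n ih =>
    simp only [continuant, convNum]
    push_cast
    rw [pow_succ]
    linear_combination -ih

/-- Continuants give best approximations, on both sides. -/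
theorem gap_le_or_le_of_lt_continuant (hα : Irrational α) (h0 : 0 < α) (h1 : α < 1) (n m : ℕ)
    (k : ℤ) (hm : 1 ≤ m) (hmq : m < continuant α (n + 1)) :
    gap α (n + 1) ≤ (-1) ^ n * (m * α - k) ∨
      (-1) ^ n * (m * α - k) ≤ -(gap α (n + 1) + gap α (n + 2)) := by
  have det := det_convergents α n
  set q : ℤ := ((continuant α n : ℕ) : ℤ) with hq
  set q' : ℤ := ((continuant α (n + 1) : ℕ) : ℤ) with hq'
  set p : ℤ := ((convNum α n : ℕ) : ℤ) with hp
  set p' : ℤ := ((convNum α (n + 1) : ℕ) : ℤ) with hp'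
  set e : ℤ := (-1) ^ n with he
  have hee : e * e = 1 := by rw [he, ← mul_pow]; simp
  -- `x` and `y` are the coordinates of `(m, k)` in the basis `(q_n, p_n)`, `(q_{n+1}, p_{n+1})`;
  -- they are integers because the determinant is `±1`.
  obtain ⟨x, hx⟩ : ∃ x : ℤ, x = e * (m * p' - k * q') := ⟨_, rfl⟩
  obtain ⟨y, hy⟩ : ∃ y : ℤ, y = e * (k * q - m * p) := ⟨_, rfl⟩
  have hm1 : (m : ℤ) = x * q + y * q' := by
    rw [hx, hy]; linear_combination -(m : ℤ) * hee - e * m * det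
  have hk1 : k = x * p + y * p' := by
    rw [hx, hy]; linear_combination -k * hee - e * k * det
  have hqpos : 0 < q := Int.natCast_pos.2 (continuant_pos α n)
  have hqpos' : 0 < q' := Int.natCast_pos.2 (continuant_pos α (n + 1))
  have hmz : (1 : ℤ) ≤ m := by exact_mod_cast hm
  have hmz' : (m : ℤ) < q' := by rw [hq']; exact_mod_cast hmq
  have key : (m : ℝ) * α - k = (-1) ^ n * (x * gap α (n + 1) - y * gap α (n + 2)) := by
    have c1 := convergent_sub hα h0 h1 n
    have c2 := convergent_sub hα h0 h1 (n + 1)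
    have hm1r : (m : ℝ) = x * continuant α n + y * continuant α (n + 1) := by exact_mod_cast hm1
    have hk1r : (k : ℝ) = x * convNum α n + y * convNum α (n + 1) := by exact_mod_cast hk1
    rw [hm1r, hk1r]
    rw [pow_succ] at c2
    linear_combination (x : ℝ) * c1 + (y : ℝ) * c2
  have hsq : ((-1 : ℝ) ^ n) * (-1) ^ n = 1 := by rw [← mul_pow]; simp
  rw [key, ← mul_assoc, hsq, one_mul]
  have g1 := gap_pos hα h0 (n + 1)
  have g2 := gap_pos hα h0 (n + 2)
  -- As `0 < m < q_{n+1}`, either `y ≤ 0 < x` or `x < 0 < y`, so the two terms of `key` never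
  -- cancel.
  rcases lt_trichotomy y 0 with hy0 | hy0 | hy0
  · have hx1 : 1 ≤ x := by
      by_contra hc
      have : x ≤ 0 := by omega
      nlinarith
    have hx1' : (1 : ℝ) ≤ x := by exact_mod_cast hx1
    have hy1' : (y : ℝ) ≤ 0 := by exact_mod_cast hy0.le
    left
    nlinarith
  · have hx1 : 1 ≤ x := by
      by_contra hc
      have : x ≤ 0 := by omega
      nlinarith
    have hx1' : (1 : ℝ) ≤ x := by exact_mod_cast hx1
    left
    rw [hy0]; push_cast
    nlinarith
  · have hx1 : x ≤ -1 := by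
      by_contra hc
      have : 0 ≤ x := by omega
      nlinarith
    have hx1' : (x : ℝ) ≤ -1 := by exact_mod_cast hx1
    have hy2' : (1 : ℝ) ≤ y := by exact_mod_cast hy0
    right
    nlinarith

theorem gap_le_of_lt_continuant (hα : Irrational α) (h0 : 0 < α) (h1 : α < 1) (n m : ℕ) (k : ℤ)
    (hm : 1 ≤ m) (hmq : m < continuant α (n + 1)) : gap α (n + 1) ≤ |m * α - k| := by
  have e : |(m : ℝ) * α - k| = |(-1) ^ n * (m * α - k)| := by simp [abs_mul]
  rw [e]
  rcases gap_le_or_le_of_lt_continuant hα h0 h1 n m k hm hmq with h | h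
  · exact h.trans (le_abs_self _)
  · refine le_trans ?_ (neg_le_abs _)
    linarith [gap_pos hα h0 (n + 2)]

theorem natCast_mul_ne_intCast (hα : Irrational α) {m : ℤ} (hm : m ≠ 0) (k : ℤ) :
    (m : ℝ) * α ≠ k := fun h =>
  (hα.intCast_mul hm) ⟨k, by rw [h]; simp⟩

theorem continuant_rec (α : ℝ) (n : ℕ) : continuant α (n + 2) =
    partQuot α (n + 2) * continuant α (n + 1) + continuant α n := rfl

theorem continuant_lt_succ (α : ℝ) (n : ℕ) : continuant α (n + 1) < continuant α (n + 2) := by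
  rw [continuant_rec]
  nlinarith [partQuot_pos α (n + 1), continuant_pos α n, continuant_pos α (n + 1)]

theorem continuant_le_succ (α : ℝ) (n : ℕ) : continuant α n ≤ continuant α (n + 1) := by
  cases n with
  | zero => exact continuant_pos α 1
  | succ n => exact (continuant_lt_succ α n).le

theorem continuant_mono (α : ℝ) : Monotone (continuant α) :=
  monotone_nat_of_le_succ (continuant_le_succ α)

theorem le_continuant (α : ℝ) (n : ℕ) : n ≤ continuant α n := by
  induction n with
  | zero => omega
  | succ n ih =>
    cases n with
    | zero => exact continuant_pos α 1
    | succ n => have := continuant_lt_succ α n; rw [show n + 1 + 1 = n + 2 from rfl]; omega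

/-- The left side is invariant under the two recurrences. It bounds `gap α (n + 1)` by `1 /
q_{n+1}`. -/
theorem gap_mul_continuant (hα : Irrational α) (h0 : 0 < α) (h1 : α < 1) (n : ℕ) :
    continuant α (n + 1) * gap α (n + 1) + continuant α n * gap α (n + 2) = 1 := by
  induction n with
  | zero =>
    have := gap_rec hα h0 h1 0
    rw [gap_zero] at this
    simpa [continuant] using this.symm
  | succ n ih =>
    have := gap_rec hα h0 h1 (n + 1)
    rw [continuant_rec]
    push_cast
    rw [this] at ih
    linear_combination ih

theorem gap_tendsto (hα : Irrational α) (h0 : 0 < α) (h1 : α < 1) :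
    Tendsto (gap α) atTop (𝓝 0) := by
  rw [← tendsto_add_atTop_iff_nat 1]
  refine squeeze_zero (fun n => (gap_pos hα h0 _).le) (fun n => ?_)
    tendsto_one_div_add_atTop_nhds_zero_nat
  have h := gap_mul_continuant hα h0 h1 n
  have h2 : (n + 1 : ℝ) ≤ continuant α (n + 1) := by exact_mod_cast le_continuant α (n + 1)
  have h3 := gap_pos hα h0 (n + 1)
  have h4 : 0 ≤ (continuant α n : ℝ) * gap α (n + 2) :=
    mul_nonneg (Nat.cast_nonneg _) (gap_pos hα h0 _).le
  rw [le_div_iff₀ (by positivity)]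
  nlinarith

/-- Adding `q_n` moves `m α` by `gap α (n + 1)` modulo 1, and best approximation keeps `m α` at
least that far from the integers on both sides. Irrationality excludes the boundary case. -/
theorem floor_add_continuant (hα : Irrational α) (h0 : 0 < α) (h1 : α < 1) (n m : ℕ)
    (hm : 1 ≤ m) (hmq : m < continuant α (n + 1)) :
    ⌊((m + continuant α n : ℕ) : ℝ) * α⌋ = convNum α n + ⌊(m : ℝ) * α⌋ := by
  have c := convergent_sub hα h0 h1 n
  have b1 := gap_le_of_lt_continuant hα h0 h1 n m ⌊(m : ℝ) * α⌋ hm hmq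
  have b2 := gap_le_of_lt_continuant hα h0 h1 n m (⌊(m : ℝ) * α⌋ + 1) hm hmq
  have f1 := Int.floor_le ((m : ℝ) * α)
  have f2 := Int.lt_floor_add_one ((m : ℝ) * α)
  rw [abs_of_nonneg (by linarith)] at b1
  push_cast at b2
  rw [abs_of_nonpos (by linarith)] at b2
  have g := gap_pos hα h0 (n + 1)
  have hirr := natCast_mul_ne_intCast hα (m := m + continuant α n) (by positivity)
    (⌊(m : ℝ) * α⌋ + 1 + convNum α n)
  rw [Int.floor_eq_iff]
  push_cast at hirr ⊢
  rcases Nat.even_or_odd n with hn | hn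
  · rw [hn.neg_one_pow] at c
    refine ⟨by linarith, ?_⟩
    refine lt_of_le_of_ne (by linarith) fun h => hirr (by linarith)
  · rw [hn.neg_one_pow] at c
    exact ⟨by linarith, by linarith⟩

/-- Density of the rotation orbit, with multipliers of a given sign. -/
theorem exists_mul_add_mem_Ioo (hα : Irrational α) (h0 : 0 < α) (h1 : α < 1) (t ε : ℝ)
    (hε : 0 < ε) :
    (∃ (i : ℕ) (k : ℤ), t < i * α + k ∧ i * α + k < t + ε) ∧
      ∃ (i : ℕ) (k : ℤ), t < -(i * α) + k ∧ -(i * α) + k < t + ε := by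
  have hg := gap_tendsto hα h0 h1
  obtain ⟨N, hN⟩ := eventually_atTop.1 (hg.eventually (gt_mem_nhds hε))
  -- Steps of length `δ < ε` that start at `⌊t⌋ ≤ t` cannot jump over the interval `(t, t + ε)`. The
  -- parity of the convergent then selects the sign of the multiplier.
  have key : ∀ δ : ℝ, 0 < δ → δ < ε → ∃ (j : ℕ), t < j * δ + ⌊t⌋ ∧ j * δ + ⌊t⌋ < t + ε := by
    intro δ hδ hδε
    have f1 := Int.floor_le t
    refine ⟨⌊(t - ⌊t⌋) / δ⌋₊ + 1, ?_, ?_⟩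
    · have := Nat.lt_floor_add_one ((t - ⌊t⌋) / δ)
      rw [div_lt_iff₀ hδ] at this
      push_cast
      linarith
    · have := Nat.floor_le (a := (t - ⌊t⌋) / δ) (div_nonneg (by linarith) hδ.le)
      rw [le_div_iff₀ hδ] at this
      push_cast
      linarith
  constructor
  · obtain ⟨j, hj⟩ := key (gap α (2 * N + 1)) (gap_pos hα h0 _) (hN _ (by omega))
    have c := convergent_sub hα h0 h1 (2 * N)
    rw [(even_two_mul N).neg_one_pow] at c
    refine ⟨j * continuant α (2 * N), ⌊t⌋ - j * convNum α (2 * N), ?_⟩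
    have e : ((j * continuant α (2 * N) : ℕ) : ℝ) * α +
        ((⌊t⌋ - j * convNum α (2 * N) : ℤ) : ℝ) = j * gap α (2 * N + 1) + ⌊t⌋ := by
      push_cast; linear_combination (j : ℝ) * c
    rw [e]; exact hj
  · obtain ⟨j, hj⟩ := key (gap α (2 * N + 1 + 1)) (gap_pos hα h0 _) (hN _ (by omega))
    have c := convergent_sub hα h0 h1 (2 * N + 1)
    rw [(odd_two_mul_add_one N).neg_one_pow] at c
    refine ⟨j * continuant α (2 * N + 1), ⌊t⌋ + j * convNum α (2 * N + 1), ?_⟩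
    have e : -(((j * continuant α (2 * N + 1) : ℕ) : ℝ) * α) +
        ((⌊t⌋ + j * convNum α (2 * N + 1) : ℤ) : ℝ) = j * gap α (2 * N + 1 + 1) + ⌊t⌋ := by
      push_cast; linear_combination -(j : ℝ) * c
    rw [e]; exact hj

/-- Two real numbers whose translates along a half orbit have floors that differ by a constant
are congruent modulo 1. -/
theorem exists_int_of_floor_sub (f : ℕ → ℝ)
    (hf : ∀ t ε : ℝ, 0 < ε → ∃ (i : ℕ) (k : ℤ), t < f i + k ∧ f i + k < t + ε)
    (x y : ℝ) (m : ℤ) (h : ∀ i, ⌊x + f i⌋ - ⌊y + f i⌋ = m) : ∃ k : ℤ, x - y = k := by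
  refine ⟨⌊x - y⌋, ?_⟩
  by_contra hne
  set θ := Int.fract (x - y) with hθ
  have hx : x = y + ⌊x - y⌋ + θ := by rw [hθ, Int.fract]; ring
  have hθ0 : 0 < θ := lt_of_le_of_ne (Int.fract_nonneg _) fun hc => hne (by linarith)
  have hθ1 : θ < 1 := Int.fract_lt_one _
  -- At `i` the translate of `y` is just past an integer and that of `x` has not reached its next
  -- one; at `j` the translate of `x` has crossed it and that of `y` has not. The floor differences
  -- at `i` and `j` differ by 1.
  obtain ⟨i, k, hi1, hi2⟩ := hf (-y) (1 - θ) (by linarith)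
  obtain ⟨j, l, hj1, hj2⟩ := hf (1 - θ - y) θ hθ0
  have a1 : ⌊y + f i⌋ = -k := by
    rw [Int.floor_eq_iff]; push_cast; constructor <;> linarith
  have a2 : ⌊x + f i⌋ = ⌊x - y⌋ - k := by
    rw [Int.floor_eq_iff]; push_cast; constructor <;> linarith
  have b1 : ⌊y + f j⌋ = -l := by
    rw [Int.floor_eq_iff]; push_cast; constructor <;> linarith
  have b2 : ⌊x + f j⌋ = ⌊x - y⌋ - l + 1 := by
    rw [Int.floor_eq_iff]; push_cast; constructor <;> linarith
  have hi := h i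
  have hj := h j
  rw [a1, a2] at hi
  rw [b1, b2] at hj
  omega

/-- If `u n` tends to `u` and is closer and closer to integers, then `u` is an integer. -/
theorem exists_int_of_tendsto {u : ℕ → ℝ} {l : ℝ} (k : ℕ → ℤ) (hu : Tendsto u atTop (𝓝 l))
    (hk : Tendsto (fun n => u n - k n) atTop (𝓝 0)) : ∃ m : ℤ, l = m := by
  have h : Tendsto (fun n => (k n : ℝ)) atTop (𝓝 l) := by
    simpa using hu.sub hk
  have := Int.isClosedEmbedding_coe_real.isClosed_range.mem_of_tendsto h
    (Eventually.of_forall fun n => ⟨k n, rfl⟩)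
  obtain ⟨m, hm⟩ := this
  exact ⟨m, hm.symm⟩

/-! ### Counting letters, words of low discrepancy -/

/-- The number of letters 1 in the factor of length `n` at position `i`. -/
def ones (x : Word) (i n : ℕ) : ℤ := ∑ j ∈ Finset.range n, if x (i + j) then 1 else 0

@[simp] theorem ones_zero (x : Word) (i : ℕ) : ones x i 0 = 0 := by simp [ones]

theorem ones_add (x : Word) (i m n : ℕ) : ones x i (m + n) = ones x i m + ones x (i + m) n := by
  simp only [ones, Finset.sum_range_add, add_assoc]

theorem ones_one (x : Word) (i : ℕ) : ones x i 1 = if x i then 1 else 0 := by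
  simp only [ones, Finset.sum_range_one, add_zero]

theorem ones_succ (x : Word) (i n : ℕ) :
    ones x i (n + 1) = ones x i n + if x (i + n) then 1 else 0 := by
  rw [ones_add, ones_one]

theorem ones_congr {x y : Word} {i j n : ℕ} (h : ∀ k < n, x (i + k) = y (j + k)) :
    ones x i n = ones y j n :=
  Finset.sum_congr rfl fun k hk => by rw [h k (Finset.mem_range.1 hk)]

@[simp] theorem length_factorAt (x : Word) (i n : ℕ) : (factorAt x i n).length = n := by
  simp [factorAt]

theorem factorAt_succ (x : Word) (i n : ℕ) :
    factorAt x i (n + 1) = factorAt x i n ++ [x (i + n)] := by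
  simp [factorAt, List.range_succ]

theorem factorAt_add (x : Word) (i m n : ℕ) :
    factorAt x i (m + n) = factorAt x i m ++ factorAt x (i + m) n := by
  induction n with
  | zero => simp [factorAt]
  | succ n ih => rw [← add_assoc, factorAt_succ, ih, factorAt_succ, List.append_assoc, add_assoc]

theorem factorAt_succ' (x : Word) (i n : ℕ) :
    factorAt x i (n + 1) = x i :: factorAt x (i + 1) n := by
  rw [add_comm, factorAt_add]; simp [factorAt]

theorem factorAt_eq_iff {x y : Word} {i j n : ℕ} :
    factorAt x i n = factorAt y j n ↔ ∀ k < n, x (i + k) = y (j + k) := by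
  simp [factorAt]

theorem isFactor_factorAt (x : Word) (i n : ℕ) : IsFactor (factorAt x i n) x :=
  ⟨i, by simp⟩

theorem take_factorAt (x : Word) (i : ℕ) {j n : ℕ} (h : j ≤ n) :
    (factorAt x i n).take j = factorAt x i j := by
  obtain ⟨k, rfl⟩ := Nat.exists_eq_add_of_le h
  rw [factorAt_add, List.take_left' (by simp)]

theorem count_factorAt (x : Word) (i n : ℕ) : ((factorAt x i n).count true : ℤ) = ones x i n := by
  induction n with
  | zero => simp [factorAt]
  | succ n ih =>
    rw [factorAt_succ, List.count_append, ones_succ, Nat.cast_add, ih]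
    cases x (i + n) <;> simp

/-- The factors `u` of `x` satisfy `||u|_1 - |u| α| < 1`. -/
def LowDiscrepancy (α : ℝ) (x : Word) : Prop := ∀ i n : ℕ, |(ones x i n : ℝ) - n * α| < 1

/-- The factors `v` of the finite word `u` satisfy `||v|_1 - |v| α| < 1`. -/
def IsAdmissible (α : ℝ) (u : List Bool) : Prop :=
  ∀ i n : ℕ, i + n ≤ u.length →
    |((((u.take (i + n)).count true : ℤ) - ((u.take i).count true : ℤ) : ℤ) : ℝ) - n * α| < 1

theorem IsAdmissible.of_isFactor {x : Word} (hx : LowDiscrepancy α x) {u : List Bool}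
    (hu : IsFactor u x) : IsAdmissible α u := by
  obtain ⟨i, hu⟩ := hu
  intro j n hj
  rw [hu, take_factorAt x i hj, take_factorAt x i (by omega), count_factorAt, count_factorAt,
    ones_add]
  simpa using hx (i + j) n

theorem eq_of_count_take_eq {u v : List Bool} (hl : u.length = v.length)
    (h : ∀ j ≤ u.length, (u.take j).count true = (v.take j).count true) : u = v := by
  refine List.ext_getElem hl fun j hu hv => ?_
  have h1 := h j hu.le
  have h2 := h (j + 1) hu
  rw [List.take_succ_eq_append_getElem hu, List.take_succ_eq_append_getElem hv, List.count_append,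
    List.count_append, h1] at h2
  have h3 : List.count true [u[j]] = List.count true [v[j]] := by omega
  revert h3
  cases u[j] <;> cases v[j] <;> simp

theorem IsAdmissible.count_take_mem {u : List Bool} (hu : IsAdmissible α u) {j : ℕ}
    (hj : j ≤ u.length) : ⌊j * α⌋ ≤ ((u.take j).count true : ℤ) ∧
      ((u.take j).count true : ℤ) ≤ ⌊j * α⌋ + 1 := by
  have h := abs_lt.1 (hu 0 j (by omega))
  simp only [zero_add, List.take_zero, List.count_nil, Nat.cast_zero, sub_zero,
    Int.cast_natCast] at h
  constructor
  · have : (⌊j * α⌋ : ℝ) < ((u.take j).count true : ℤ) + 1 := by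
      have := Int.floor_le (j * α); push_cast; linarith
    exact_mod_cast Int.lt_add_one_iff.1 (by exact_mod_cast this)
  · have : (((u.take j).count true : ℤ) : ℝ) < ⌊j * α⌋ + 1 + 1 := by
      have := Int.lt_floor_add_one (j * α); push_cast; linarith
    exact Int.lt_add_one_iff.1 (by exact_mod_cast this)

/-- If the prefix counts of `u` and `v` crossed, then between `j` and `k` the two words would gain
numbers of 1s that differ by at least 2, although both gains are within 1 of the same multiple of
`α`. So prefix counts of admissible words of one length are totally ordered. -/
theorem IsAdmissible.comparable {u v : List Bool} (hu : IsAdmissible α u) (hv : IsAdmissible α v)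
    (hl : u.length = v.length) {j k : ℕ} (hj : j ≤ u.length) (hk : k ≤ u.length)
    (h1 : (u.take j).count true < (v.take j).count true)
    (h2 : (v.take k).count true < (u.take k).count true) : False := by
  wlog hjk : j ≤ k generalizing u v j k
  · exact this hv hu hl.symm (by omega) (by omega) h2 h1 (by omega)
  obtain ⟨n, rfl⟩ := Nat.exists_eq_add_of_le hjk
  have a := abs_lt.1 (hu j n hk)
  have b := abs_lt.1 (hv j n (by omega))
  have c : ((v.take (j + n)).count true : ℤ) - ((v.take j).count true : ℤ) + 2 ≤
    ((u.take (j + n)).count true : ℤ) - ((u.take j).count true : ℤ) := by omega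
  have c' : ((((v.take (j + n)).count true : ℤ) - ((v.take j).count true : ℤ) : ℤ) : ℝ) + 2 ≤
    ((((u.take (j + n)).count true : ℤ) - ((u.take j).count true : ℤ) : ℤ) : ℝ) := by
    exact_mod_cast c
  linarith

theorem admissible_finite (α : ℝ) (n : ℕ) :
    {u : List Bool | u.length = n ∧ IsAdmissible α u}.Finite :=
  (List.finite_length_eq Bool n).subset fun _ h => h.1

/-- The sum `φ` of the excesses of the prefix counts over `⌊j α⌋` is injective by comparability.
Each excess is 0 or 1 and the one for `j = 0` vanishes, so `φ` takes values in `[0, n]`. -/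
theorem ncard_admissible_le (α : ℝ) (n : ℕ) :
    {u : List Bool | u.length = n ∧ IsAdmissible α u}.ncard ≤ n + 1 := by
  set φ : List Bool → ℤ := fun u =>
    ∑ j ∈ Finset.range (n + 1), (((u.take j).count true : ℤ) - ⌊j * α⌋) with hφ
  have hcard : ((Finset.Icc (0 : ℤ) n : Finset ℤ) : Set ℤ).ncard = n + 1 := by
    rw [Set.ncard_coe_finset]; simp
  rw [← hcard]
  refine Set.ncard_le_ncard_of_injOn φ ?_ ?_ (Finset.finite_toSet _)
  · rintro u ⟨hl, hu⟩
    have hb : ∀ j ∈ Finset.range (n + 1), 0 ≤ (((u.take j).count true : ℤ) - ⌊j * α⌋) ∧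
        (((u.take j).count true : ℤ) - ⌊j * α⌋) ≤ 1 := by
      intro j hj
      have := hu.count_take_mem (j := j) (by rw [hl]; have := Finset.mem_range.1 hj; omega)
      omega
    rw [Finset.mem_coe, Finset.mem_Icc]
    refine ⟨Finset.sum_nonneg fun j hj => (hb j hj).1, ?_⟩
    simp only [hφ]
    rw [Finset.sum_range_succ']
    have : ∑ k ∈ Finset.range n, (((u.take (k + 1)).count true : ℤ) - ⌊((k + 1 : ℕ) : ℝ) * α⌋) ≤
        ∑ k ∈ Finset.range n, 1 :=
      Finset.sum_le_sum fun k hk => (hb (k + 1) (by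
        have := Finset.mem_range.1 hk; exact Finset.mem_range.2 (by omega))).2
    simpa using this
  · rintro u ⟨hul, hu⟩ v ⟨hvl, hv⟩ huv
    have hs : ∑ j ∈ Finset.range (n + 1), ((u.take j).count true : ℤ) =
        ∑ j ∈ Finset.range (n + 1), ((v.take j).count true : ℤ) := by
      simp only [hφ, Finset.sum_sub_distrib] at huv
      linarith
    refine eq_of_count_take_eq (hul.trans hvl.symm) fun j hj => ?_
    have hj' : j ∈ Finset.range (n + 1) := Finset.mem_range.2 (by omega)
    rcases lt_trichotomy ((u.take j).count true) ((v.take j).count true) with h | h | h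
    · refine absurd hs (ne_of_lt (Finset.sum_lt_sum (fun k hk => ?_) ⟨j, hj', by exact_mod_cast h⟩))
      by_contra hc
      have := Finset.mem_range.1 hk
      exact hu.comparable hv (hul.trans hvl.symm) hj (k := k) (by omega) h (by omega)
    · exact h
    · refine absurd hs.symm
        (ne_of_lt (Finset.sum_lt_sum (fun k hk => ?_) ⟨j, hj', by exact_mod_cast h⟩))
      by_contra hc
      have := Finset.mem_range.1 hk
      exact hv.comparable hu (hvl.trans hul.symm) (j := j) (k := k) (by omega) (by omega) h
        (by omega)

/-- Words of low discrepancy are codings of rotations. -/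
theorem LowDiscrepancy.exists_intercept {x : Word} (hx : LowDiscrepancy α x) :
    ∃ s : ℝ, ∀ i : ℕ, (∀ k : ℤ, i * α + s ≠ k) → ones x 0 i = ⌊i * α + s⌋ := by
  set D : ℕ → ℝ := fun i => ones x 0 i - i * α with hD
  have hdiff : ∀ m i, D m ≤ D i + 1 := by
    intro m i
    rcases le_total i m with h | h
    · obtain ⟨n, rfl⟩ := Nat.exists_eq_add_of_le h
      have := abs_lt.1 (hx i n)
      simp only [hD, ones_add]
      push_cast
      rw [zero_add]
      linarith
    · obtain ⟨n, rfl⟩ := Nat.exists_eq_add_of_le h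
      have := abs_lt.1 (hx m n)
      simp only [hD, ones_add]
      push_cast
      rw [zero_add]
      linarith
  have hbdd : BddAbove (Set.range D) := ⟨D 0 + 1, by rintro _ ⟨m, rfl⟩; exact hdiff m 0⟩
  -- Since `D` oscillates by at most 1, its supremum `s` satisfies `D i ≤ s ≤ D i + 1`, which traps
  -- `i α + s` between consecutive integers.
  refine ⟨sSup (Set.range D), fun i hi => ?_⟩
  have h1 : D i ≤ sSup (Set.range D) := le_csSup hbdd ⟨i, rfl⟩
  have h2 : sSup (Set.range D) ≤ D i + 1 :=
    csSup_le ⟨_, i, rfl⟩ (by rintro _ ⟨m, rfl⟩; exact hdiff m i)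
  have h3 := hi (ones x 0 i + 1)
  simp only [hD] at h1 h2
  symm
  rw [Int.floor_eq_iff]
  push_cast at h3
  refine ⟨by linarith, lt_of_le_of_ne (by linarith) fun h => h3 (by linarith)⟩

theorem exists_pos_add_le_floor (α t : ℝ) (n : ℕ) :
    ∃ ε > 0, ∀ k ≤ n, t + k * α + ε ≤ ⌊t + k * α⌋ + 1 := by
  obtain ⟨k₀, -, hk₀⟩ := Finset.exists_min_image (Finset.range (n + 1))
    (fun k : ℕ => (⌊t + k * α⌋ + 1 : ℝ) - (t + k * α)) ⟨0, by simp⟩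
  refine ⟨_, sub_pos.2 (Int.lt_floor_add_one (t + k₀ * α)), fun k hk => ?_⟩
  have := hk₀ k (Finset.mem_range.2 (by omega))
  linarith

/-- By density some `i α + s` lies just to the right of `t` modulo 1, close enough for the first `n`
translates to have the same floors. -/
theorem LowDiscrepancy.exists_coding (hα : Irrational α) (h0 : 0 < α) (h1 : α < 1) {x : Word}
    (hx : LowDiscrepancy α x) (t : ℝ) (n : ℕ) :
    ∃ i, ∀ k ≤ n, ones x i k = ⌊t + k * α⌋ - ⌊t⌋ := by
  obtain ⟨s, hs⟩ := hx.exists_intercept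
  obtain ⟨ε, hε, hk⟩ := exists_pos_add_le_floor α t n
  obtain ⟨i, z, hz1, hz2⟩ := (exists_mul_add_mem_Ioo hα h0 h1 (t - s) ε hε).1
  have key : ∀ k ≤ n, ones x 0 (i + k) = ⌊t + k * α⌋ - z := by
    intro k hkn
    have a := hk k hkn
    have b := Int.floor_le (t + k * α)
    have e : ((i + k : ℕ) : ℝ) * α + s = (i * α + z - (t - s)) + (t + k * α) - z := by
      push_cast; ring
    rw [hs (i + k), e, Int.floor_eq_iff]
    · push_cast; constructor <;> linarith
    · intro m hm
      rw [e] at hm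
      have l1 : (⌊t + k * α⌋ : ℝ) < (m + z : ℤ) := by push_cast; linarith
      have l2 : ((m + z : ℤ) : ℝ) < (⌊t + k * α⌋ + 1 : ℤ) := by push_cast; linarith
      have l1' : ⌊t + k * α⌋ < m + z := by exact_mod_cast l1
      have l2' : m + z < ⌊t + k * α⌋ + 1 := by exact_mod_cast l2
      omega
  refine ⟨i, fun k hkn => ?_⟩
  have a := key k hkn
  have b := key 0 (by omega)
  rw [ones_add, zero_add] at a
  simp only [add_zero, Nat.cast_zero, zero_mul] at b
  omega

/-- The rotation codings that start at `-j α`, for `0 ≤ j ≤ n`, occur as factors. If those for `a <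
b` agreed, their counts at lengths `a` and `b` would give `⌊-(b - a) α⌋ = -⌊(b - a) α⌋`, impossible
as `α` is irrational. -/
theorem LowDiscrepancy.le_complexity (hα : Irrational α) (h0 : 0 < α) (h1 : α < 1) {x : Word}
    (hx : LowDiscrepancy α x) (n : ℕ) : n + 1 ≤ complexity x n := by
  have hc : ∀ j : ℕ, ∃ i, ∀ k ≤ n, ones x i k = ⌊-(j * α) + k * α⌋ - ⌊-(j * α)⌋ := fun j =>
    hx.exists_coding hα h0 h1 _ n
  choose i hi using hc
  have hcard : ((Finset.range (n + 1) : Finset ℕ) : Set ℕ).ncard = n + 1 := by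
    rw [Set.ncard_coe_finset]; simp
  rw [← hcard]
  refine Set.ncard_le_ncard_of_injOn (fun j => factorAt x (i j) n) ?_ ?_
    ((List.finite_length_eq Bool n).subset fun _ h => h.1)
  · intro j _
    exact ⟨by simp, isFactor_factorAt _ _ _⟩
  · intro a ha b hb hab
    by_contra hne
    wlog hlt : a < b generalizing a b
    · exact this hb ha hab.symm (Ne.symm hne) (by omega)
    rw [Finset.mem_coe, Finset.mem_range] at ha hb
    have hab' : ∀ k ≤ n, ones x (i a) k = ones x (i b) k := fun k hk =>
      ones_congr fun l hl => factorAt_eq_iff.1 hab l (by omega)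
    have ea := hab' a (by omega)
    have eb := hab' b (by omega)
    rw [hi a a (by omega), hi b a (by omega)] at ea
    rw [hi a b (by omega), hi b b (by omega)] at eb
    rw [neg_add_cancel, Int.floor_zero] at ea eb
    have hz : ((b : ℤ) - a : ℤ) ≠ 0 := by omega
    have hf : ⌊-(b * α) + a * α⌋ = -1 - ⌊-(a * α) + b * α⌋ := by
      have e : -(b * α) + a * α = -(-(a * α) + b * α) := by ring
      have hne := natCast_mul_ne_intCast hα hz ⌊-(a * α) + b * α⌋
      have f1 := Int.floor_le (-(a * α) + b * α)
      have f2 := Int.lt_floor_add_one (-(a * α) + b * α)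
      rw [e, Int.floor_eq_iff]
      push_cast at hne ⊢
      refine ⟨by linarith, ?_⟩
      have : (⌊-(a * α) + b * α⌋ : ℝ) < -(a * α) + b * α :=
        lt_of_le_of_ne f1 fun h => hne (by linarith)
      linarith
    omega

/-- Factors are admissible, there are at least `n + 1` of them and at most `n + 1` admissible words.
Hence all words of low discrepancy for `α` share their factors. -/
theorem LowDiscrepancy.factors_eq (hα : Irrational α) (h0 : 0 < α) (h1 : α < 1) {x : Word}
    (hx : LowDiscrepancy α x) (n : ℕ) : {u : List Bool | u.length = n ∧ IsFactor u x} =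
      {u : List Bool | u.length = n ∧ IsAdmissible α u} :=
  Set.eq_of_subset_of_ncard_le (fun _ hu => ⟨hu.1, IsAdmissible.of_isFactor hx hu.2⟩)
    ((ncard_admissible_le α n).trans (hx.le_complexity hα h0 h1 n)) (admissible_finite α n)

theorem LowDiscrepancy.isFactor_iff (hα : Irrational α) (h0 : 0 < α) (h1 : α < 1) {x : Word}
    (hx : LowDiscrepancy α x) (u : List Bool) : IsFactor u x ↔ IsAdmissible α u := by
  have := Set.ext_iff.1 (hx.factors_eq hα h0 h1 u.length) u
  simpa using this

theorem LowDiscrepancy.isSturmianOfSlope (hα : Irrational α) (h0 : 0 < α) (h1 : α < 1) {x : Word}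
    (hx : LowDiscrepancy α x) : IsSturmianOfSlope α x := by
  refine ⟨fun n _ => le_antisymm ?_ (hx.le_complexity hα h0 h1 n), fun ε hε => ?_⟩
  · rw [complexity, hx.factors_eq hα h0 h1]
    exact ncard_admissible_le α n
  · obtain ⟨N, hN⟩ := exists_nat_gt (1 / ε)
    refine ⟨N + 1, fun u ⟨i, hu⟩ hl => ?_⟩
    have h := hx i u.length
    rw [← count_factorAt, ← hu, Int.cast_natCast] at h
    have hlen : (N + 1 : ℝ) ≤ u.length := by exact_mod_cast hl
    have hpos : (0 : ℝ) < u.length := by linarith [Nat.cast_nonneg (α := ℝ) N]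
    have e : (u.count true : ℝ) / u.length - α = (u.count true - u.length * α) / u.length := by
      field_simp
    rw [e, abs_div, abs_of_pos hpos, div_lt_iff₀ hpos]
    rw [div_lt_iff₀ hε] at hN
    nlinarith

/-! ### Sturmian words are balanced -/

/-- `u` is a right special factor of `x`. -/
def IsRightSpecial (x : Word) (u : List Bool) : Prop := ∀ b, IsFactor (u ++ [b]) x

theorem complexity_zero (x : Word) : complexity x 0 = 1 := by
  have : {u : List Bool | u.length = 0 ∧ IsFactor u x} = {[]} := by
    ext u
    simp only [Set.mem_ofPred_eq, List.length_eq_zero_iff, Set.mem_singleton_iff, and_iff_left_iff_imp]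
    rintro rfl
    exact ⟨0, by simp [factorAt]⟩
  rw [complexity, this, Set.ncard_singleton]

theorem IsSturmian.complexity_eq {x : Word} (hx : IsSturmian x) (n : ℕ) :
    complexity x n = n + 1 := by
  cases n with
  | zero => exact complexity_zero x
  | succ n => exact hx _ (by omega)

theorem factors_finite (x : Word) (n : ℕ) : {u : List Bool | u.length = n ∧ IsFactor u x}.Finite :=
  (List.finite_length_eq Bool n).subset fun _ h => h.1

theorem IsFactor.of_append_left {x : Word} {u v : List Bool} (h : IsFactor (u ++ v) x) :
    IsFactor u x := by
  obtain ⟨i, h⟩ := h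
  rw [List.length_append, factorAt_add] at h
  exact ⟨i, (List.append_inj h (by simp)).1⟩

theorem IsFactor.of_append_right {x : Word} {u v : List Bool} (h : IsFactor (u ++ v) x) :
    IsFactor v x := by
  obtain ⟨i, h⟩ := h
  rw [List.length_append, factorAt_add] at h
  exact ⟨_, (List.append_inj h (by simp)).2⟩

theorem IsFactor.exists_append {x : Word} {u : List Bool} (h : IsFactor u x) :
    ∃ b, IsFactor (u ++ [b]) x := by
  obtain ⟨i, h⟩ := h
  refine ⟨x (i + u.length), i, ?_⟩
  rw [List.length_append, List.length_singleton, factorAt_succ, ← h]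

theorem IsRightSpecial.isFactor {x : Word} {u : List Bool} (h : IsRightSpecial x u) :
    IsFactor u x := (h true).of_append_left

theorem IsRightSpecial.of_append {x : Word} {u v : List Bool} (h : IsRightSpecial x (u ++ v)) :
    IsRightSpecial x v := fun b => by
  have := h b
  rw [List.append_assoc] at this
  exact this.of_append_right

theorem IsSturmian.exists_rightSpecial {x : Word} (hx : IsSturmian x) (n : ℕ) :
    ∃ r, r.length = n ∧ IsRightSpecial x r := by
  by_contra hcon
  push Not at hcon
  have h : complexity x (n + 1) ≤ complexity x n := by
    refine Set.ncard_le_ncard_of_injOn List.dropLast ?_ ?_ (factors_finite x n)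
    · rintro u ⟨hl, hu⟩
      refine ⟨by simp [hl], ?_⟩
      have hne : u ≠ [] := by rintro rfl; simp at hl
      rw [← List.dropLast_append_getLast hne] at hu
      exact hu.of_append_left
    · rintro u ⟨hul, hu⟩ v ⟨hvl, hv⟩ huv
      have hune : u ≠ [] := by rintro rfl; simp at hul
      have hvne : v ≠ [] := by rintro rfl; simp at hvl
      by_contra hne
      rw [← List.dropLast_append_getLast hune] at hu hne
      rw [← List.dropLast_append_getLast hvne, ← huv] at hv hne
      refine hcon u.dropLast (by simp [hul]) fun b => ?_
      have : u.getLast hune ≠ v.getLast hvne := fun h => hne (by rw [h])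
      by_cases hb : b = u.getLast hune
      · rw [hb]; exact hu
      · have : b = v.getLast hvne := by
          revert this hb
          cases b <;> cases u.getLast hune <;> cases v.getLast hvne <;> simp
        rw [this]; exact hv
  rw [hx.complexity_eq, hx.complexity_eq] at h
  omega

/-- Each factor of length `n` has a right extension, chosen by `g`; two right special ones would
supply two more, hence `n + 3` factors of length `n + 1`. -/
theorem IsSturmian.rightSpecial_unique {x : Word} (hx : IsSturmian x) {r r' : List Bool}
    (hl : r.length = r'.length) (hr : IsRightSpecial x r) (hr' : IsRightSpecial x r') :
    r = r' := by
  classical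
  by_contra hne
  set n := r.length with hn
  set g : List Bool → List Bool := fun v =>
    if IsFactor (v ++ [true]) x then v ++ [true] else v ++ [false] with hg
  have hginj : Function.Injective g := by
    intro u v huv
    simp only [hg] at huv
    split_ifs at huv <;> exact (List.append_inj' huv rfl).1
  have hgr : g r = r ++ [true] := if_pos (hr true)
  have hgr' : g r' = r' ++ [true] := if_pos (hr' true)
  have h1 : r ++ [false] ∉ g '' {u : List Bool | u.length = n ∧ IsFactor u x} := by
    rintro ⟨u, -, hu⟩
    have : u = r := by
      simp only [hg] at hu
      split_ifs at hu <;> exact (List.append_inj' hu rfl).1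
    rw [this, hgr] at hu
    simp at hu
  have h2 : r' ++ [false] ∉
      insert (r ++ [false]) (g '' {u : List Bool | u.length = n ∧ IsFactor u x}) := by
    rintro (h | ⟨u, -, hu⟩)
    · exact hne (List.append_inj' h rfl).1.symm
    · have : u = r' := by
        simp only [hg] at hu
        split_ifs at hu <;> exact (List.append_inj' hu rfl).1
      rw [this, hgr'] at hu
      simp at hu
  have hfin := (factors_finite x n).image g
  have hsub : insert (r' ++ [false]) (insert (r ++ [false])
      (g '' {u : List Bool | u.length = n ∧ IsFactor u x})) ⊆
      {u : List Bool | u.length = n + 1 ∧ IsFactor u x} := by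
    rintro u (rfl | rfl | ⟨v, ⟨hvl, hv⟩, rfl⟩)
    · exact ⟨by simp [← hl], hr' false⟩
    · exact ⟨by simp [hn], hr false⟩
    · simp only [hg]
      split_ifs with h
      · exact ⟨by simp [hvl], h⟩
      · obtain ⟨b, hb⟩ := hv.exists_append
        cases b with
        | true => exact absurd hb h
        | false => exact ⟨by simp [hvl], hb⟩
  have hle := Set.ncard_le_ncard hsub (factors_finite x (n + 1))
  rw [Set.ncard_insert_of_notMem h2 (hfin.insert _), Set.ncard_insert_of_notMem h1 hfin,
    Set.ncard_image_of_injective _ hginj] at hle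
  have a := hx.complexity_eq n
  have b := hx.complexity_eq (n + 1)
  rw [complexity] at a b
  omega

/-- A Sturmian word is not eventually periodic. -/
theorem IsSturmian.not_eventually_periodic {x : Word} (hx : IsSturmian x) {p P : ℕ} (hP : 0 < P)
    (h : ∀ m, p ≤ m → x (m + P) = x m) : False := by
  have hred : ∀ m, ∃ m' < p + P, ∀ k, x (m + k) = x (m' + k) := by
    intro m
    induction m using Nat.strong_induction_on with
    | _ m ih =>
      by_cases hm : m < p + P
      · exact ⟨m, hm, fun _ => rfl⟩
      · obtain ⟨m', hm', hk⟩ := ih (m - P) (by omega)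
        refine ⟨m', hm', fun k => ?_⟩
        rw [← hk, ← h (m - P + k) (by omega)]
        congr 1; omega
  have hle : complexity x (p + P) ≤ p + P := by
    have hc : ((Finset.range (p + P) : Finset ℕ) : Set ℕ).ncard = p + P := by
      rw [Set.ncard_coe_finset]; simp
    rw [← hc]
    refine le_trans (Set.ncard_le_ncard (t := (fun m => factorAt x m (p + P)) ''
      ((Finset.range (p + P) : Finset ℕ) : Set ℕ)) ?_ ((Finset.finite_toSet _).image _))
      (Set.ncard_image_le (Finset.finite_toSet _))
    rw [hc]
    rintro u ⟨hl, i, hu⟩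
    obtain ⟨m', hm', hk⟩ := hred i
    refine ⟨m', by simpa using hm', ?_⟩
    rw [hu, hl]
    exact factorAt_eq_iff.2 fun k _ => (hk k).symm
  rw [hx.complexity_eq] at hle
  omega

/-- The right special factor of length `n` of a Sturmian word occurs in each window of `n + 1`
consecutive positions. -/
theorem IsSturmian.exists_factorAt_eq {x : Word} (hx : IsSturmian x) {n : ℕ} {r : List Bool}
    (hl : r.length = n) (hr : IsRightSpecial x r) (p : ℕ) : ∃ m ≤ n, factorAt x (p + m) n = r := by
  by_contra hcon
  push Not at hcon
  -- Pigeonhole: `n + 1` positions share the `n` factors other than `r`.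
  obtain ⟨a, ha, b, hb, hab, heq⟩ :
      ∃ a ∈ Finset.range (n + 1), ∃ b ∈ Finset.range (n + 1), a ≠ b ∧
        factorAt x (p + a) n = factorAt x (p + b) n := by
    refine Finset.exists_ne_map_eq_of_card_lt_of_maps_to
      (t := (factors_finite x n).toFinset.erase r) ?_ ?_
    · rw [Finset.card_erase_of_mem (by simp [hl, hr.isFactor]), ← Set.ncard_eq_toFinset_card _ (factors_finite x n)]
      have := hx.complexity_eq n
      rw [complexity] at this
      simp [this]
    · intro a ha
      have := Finset.mem_range.1 ha
      simp only [Finset.coe_erase, Set.Finite.coe_toFinset, Set.mem_sdiff, Set.mem_ofPred_eq,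
        Set.mem_singleton_iff]
      exact ⟨⟨by simp, isFactor_factorAt _ _ _⟩, hcon a (by omega)⟩
  wlog hlt : a < b generalizing a b
  · exact this b hb a ha hab.symm heq.symm (by omega)
  rw [Finset.mem_range] at ha hb
  have hdet : ∀ i j, factorAt x i n = factorAt x j n → factorAt x i n ≠ r →
      factorAt x (i + 1) n = factorAt x (j + 1) n := by
    intro i j hij hne
    have hlast : x (i + n) = x (j + n) := by
      by_contra hc
      refine hne (hx.rightSpecial_unique (by simp [hl]) (fun c => ?_) hr)
      by_cases hci : c = x (i + n)
      · rw [hci, ← factorAt_succ]; exact isFactor_factorAt _ _ _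
      · have : c = x (j + n) := by
          revert hci hc
          cases c <;> cases x (i + n) <;> cases x (j + n) <;> simp
        rw [this, hij, ← factorAt_succ]; exact isFactor_factorAt _ _ _
    have h : factorAt x i (n + 1) = factorAt x j (n + 1) := by
      rw [factorAt_succ, factorAt_succ, hij, hlast]
    rw [factorAt_succ', factorAt_succ'] at h
    exact (List.cons.inj h).2
  -- A factor other than `r` determines the next letter, so the repetition propagates and never
  -- meets `r`, which makes `x` eventually periodic.
  have hstep : ∀ k, factorAt x (p + a + k) n = factorAt x (p + b + k) n ∧
      factorAt x (p + a + k) n ≠ r := by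
    intro k
    induction k using Nat.strong_induction_on with
    | _ k ih =>
      have hne : factorAt x (p + a + k) n ≠ r := by
        by_cases hk : a + k < b
        · rw [add_assoc]; exact hcon _ (by omega)
        · have := ih (a + k - b) (by omega)
          rw [show p + a + k = p + b + (a + k - b) by omega, ← this.1]
          exact this.2
      refine ⟨?_, hne⟩
      cases k with
      | zero => exact heq
      | succ k => exact hdet _ _ (ih k (by omega)).1 (ih k (by omega)).2
  rcases Nat.eq_zero_or_pos n with rfl | hn
  · refine hcon 0 le_rfl ?_
    rw [List.eq_nil_of_length_eq_zero hl]
    simp [factorAt]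
  refine hx.not_eventually_periodic (p := p + a) (P := b - a) (by omega) fun m hm => ?_
  have h := factorAt_eq_iff.1 (hstep (m - (p + a))).1 0 hn
  rw [show m + (b - a) = p + b + (m - (p + a)) + 0 by omega, ← h]
  congr 1; omega

/-- An unbalanced word has factors `0w0` and `1w1`, with `w` a palindrome. -/
theorem exists_palindrome_of_unbalanced {x : Word}
    (h : ∃ n i j, ones x j n + 2 ≤ ones x i n) :
    ∃ L i j, x i = true ∧ x (i + (L + 1)) = true ∧ x j = false ∧ x (j + (L + 1)) = false ∧
      (∀ k < L, x (i + 1 + k) = x (j + 1 + k)) ∧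
      ∀ k < L, x (i + 1 + k) = x (i + (L - k)) := by
  classical
  obtain ⟨i, j, hij⟩ := Nat.find_spec h
  have hmin : ∀ m < Nat.find h, ∀ i j, ones x i m ≤ ones x j m + 1 := by
    intro m hm i j
    by_contra hc
    exact Nat.find_min h hm ⟨i, j, by omega⟩
  generalize Nat.find h = n at hij hmin
  have hone : ∀ i, ones x i 1 = 0 ∨ ones x i 1 = 1 := by
    intro i; rw [ones_one]; split_ifs <;> simp
  have htrue : ∀ i, ones x i 1 = 1 → x i = true := by
    intro i; rw [ones_one]; split_ifs with h <;> simp [h]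
  have hfalse : ∀ i, ones x i 1 = 0 → x i = false := by
    intro i; rw [ones_one]; split_ifs with h <;> simp [h]
  have heq : ∀ i j, ones x i 1 = ones x j 1 → x i = x j := by
    intro i j h
    rcases hone i with h1 | h1
    · rw [hfalse i h1, hfalse j (h ▸ h1)]
    · rw [htrue i h1, htrue j (h ▸ h1)]
  have hn : 2 ≤ n := by
    by_contra hc
    have : n = 0 ∨ n = 1 := by omega
    rcases this with rfl | rfl
    · simp at hij
    · have := hone i; have := hone j; omega
  obtain ⟨L, rfl⟩ := Nat.exists_eq_add_of_le' hn
  -- A surplus of 2 splits over a prefix and a suffix, each with surplus at most 1 by minimality of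
  -- the length; so each is exactly 1.
  have hmid : ∀ m, m ≤ L → ones x i (1 + m) = ones x j (1 + m) + 1 := by
    intro m hm
    have a := hmin (1 + m) (by omega) i j
    have b := hmin (L + 1 - m) (by omega) (i + (1 + m)) (j + (1 + m))
    have c := ones_add x i (1 + m) (L + 1 - m)
    have d := ones_add x j (1 + m) (L + 1 - m)
    rw [show 1 + m + (L + 1 - m) = L + 2 by omega] at c d
    omega
  have hi0 := hmid 0 (by omega)
  have hiL := hmid L le_rfl
  have ci := ones_add x i (1 + L) 1
  have cj := ones_add x j (1 + L) 1
  rw [show 1 + L + 1 = L + 2 by omega] at ci cj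
  have oi := hone i
  have oj := hone j
  have oi' := hone (i + (1 + L))
  have oj' := hone (j + (1 + L))
  simp only [add_zero] at hi0
  have hw : ∀ m, m ≤ L → ones x (i + 1) m = ones x (j + 1) m := by
    intro m hm
    have a := hmid m hm
    rw [ones_add, ones_add] at a
    omega
  have hlet : ∀ k < L, x (i + 1 + k) = x (j + 1 + k) := by
    intro k hk
    apply heq
    have a := hw k hk.le
    have b := hw (k + 1) hk
    rw [ones_add, ones_add] at b
    omega
  -- Compare a prefix of `1w1` with a suffix of `0w0`, and a suffix of `1w1` with a prefix of `0w0`: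
  -- minimality forces prefixes and suffixes of `w` of equal length to have equal counts.
  have hpal : ∀ k ≤ L, ones x (i + 1) k = ones x (i + 1 + (L - k)) k := by
    intro k hk
    have a := hmin (1 + k) (by omega) i (j + 1 + (L - k))
    have b := hmin (1 + k) (by omega) (i + 1 + (L - k)) j
    rw [ones_add x i, add_comm 1 k, ones_add x (j + 1 + (L - k)),
      show j + 1 + (L - k) + k = j + (1 + L) by omega] at a
    rw [ones_add x j, add_comm 1 k, ones_add x (i + 1 + (L - k)),
      show i + 1 + (L - k) + k = i + (1 + L) by omega] at b
    have e : ones x (i + 1 + (L - k)) k = ones x (j + 1 + (L - k)) k :=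
      ones_congr fun l hl => by
        rw [add_assoc _ (L - k), add_assoc _ (L - k)]; exact hlet _ (by omega)
    have f := hw k hk
    omega
  rw [add_comm 1 L] at oi' oj' ci cj hiL
  refine ⟨L, i, j, htrue _ (by omega), htrue _ (by omega), hfalse _ (by omega), hfalse _ (by omega),
    hlet, fun k hk => heq _ _ ?_⟩
  have a := hpal k hk.le
  have b := hpal (k + 1) hk
  rw [ones_add, add_comm k 1, ones_add x (i + 1 + (L - (1 + k))),
    show i + 1 + (L - (1 + k)) + 1 = i + 1 + (L - k) by omega,
    show i + 1 + (L - (1 + k)) = i + (L - k) by omega] at b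
  omega

/-- Otherwise `0w0` and `1w1` are factors with `w` a palindrome. Then `w` is right special, and the
right special factor one letter longer is `aw` for some letter `a`. It must start at one of the `L +
2` positions of an occurrence of `(!a)w(!a)`. It cannot start at either end letter, and an interior
start puts `a` and `!a` at mirror positions of `w`. -/
theorem IsSturmian.balanced {x : Word} (hx : IsSturmian x) (n i j : ℕ) :
    ones x i n ≤ ones x j n + 1 := by
  by_contra hcon
  obtain ⟨L, i, j, hi, hi', hj, hj', hij, hpal⟩ :=
    exists_palindrome_of_unbalanced (x := x) ⟨n, i, j, by omega⟩
  set w := factorAt x (i + 1) L with hw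
  have hwj : factorAt x (j + 1) L = w := factorAt_eq_iff.2 fun k hk => (hij k hk).symm
  have hocc : ∀ b, ∃ p, x p = b ∧ factorAt x (p + 1) L = w ∧ x (p + (L + 1)) = b := by
    intro b
    cases b with
    | true => exact ⟨i, hi, rfl, hi'⟩
    | false => exact ⟨j, hj, hwj, hj'⟩
  have hext : ∀ p, factorAt x p (L + 1 + 1) =
      (x p :: factorAt x (p + 1) L) ++ [x (p + (L + 1))] := by
    intro p; rw [factorAt_succ, factorAt_succ']
  have hws : IsRightSpecial x w := by
    intro b
    obtain ⟨p, -, hp, hpb⟩ := hocc b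
    have := isFactor_factorAt x p (L + 1 + 1)
    rw [hext, hp, hpb, ← List.singleton_append, List.append_assoc] at this
    exact this.of_append_right
  obtain ⟨r, hrl, hr⟩ := hx.exists_rightSpecial (L + 1)
  obtain ⟨a, r', rfl⟩ := List.exists_cons_of_length_eq_add_one hrl
  have hr' : r' = w := by
    refine hx.rightSpecial_unique (by simpa [hw] using hrl) ?_ hws
    rw [← List.singleton_append] at hr
    exact hr.of_append
  subst hr'
  obtain ⟨p, hp1, hp2, hp3⟩ := hocc (!a)
  obtain ⟨m, hm, hmr⟩ := hx.exists_factorAt_eq hrl hr p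
  rw [factorAt_succ'] at hmr
  obtain ⟨hma, hmw⟩ := List.cons.inj hmr
  rcases Nat.eq_zero_or_pos m with rfl | hm0
  · rw [add_zero, hp1] at hma
    cases a <;> simp at hma
  rcases hm.eq_or_lt with rfl | hmL
  · rw [hp3] at hma
    cases a <;> simp at hma
  have e1 : x (p + 1 + (m - 1)) = a := by rw [← hma]; congr 1; omega
  have e2 : x (i + 1 + (m - 1)) = a := by
    rw [← e1]; exact (factorAt_eq_iff.1 hp2 _ (by omega)).symm
  have e3 : x (p + m + 1 + (L - m)) = !a := by rw [← hp3]; congr 1; omega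
  have e4 : x (i + 1 + (L - m)) = !a := by
    rw [← e3]; exact (factorAt_eq_iff.1 hmw _ (by omega)).symm
  have e5 := hpal (m - 1) (by omega)
  rw [e2, show i + (L - (m - 1)) = i + 1 + (L - m) by omega, e4] at e5
  cases a <;> simp at e5

theorem ones_mul_le {x : Word} {n : ℕ} {c : ℤ} (h : ∀ i, ones x i n ≤ c) (k : ℕ) :
    ones x 0 (k * n) ≤ k * c := by
  induction k with
  | zero => simp
  | succ k ih => rw [Nat.succ_mul, ones_add]; push_cast; linarith [h (0 + k * n)]

theorem le_ones_mul {x : Word} {n : ℕ} {c : ℤ} (h : ∀ i, c ≤ ones x i n) (k : ℕ) :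
    k * c ≤ ones x 0 (k * n) := by
  induction k with
  | zero => simp
  | succ k ih => rw [Nat.succ_mul, ones_add]; push_cast; linarith [h (0 + k * n)]

theorem HasSlope.exists_abs_lt {x : Word} (hx : HasSlope x α) {n : ℕ} (hn : 1 ≤ n) {ε : ℝ}
    (hε : 0 < ε) : ∃ k : ℕ, 1 ≤ k ∧ |(ones x 0 (k * n) : ℝ) - k * n * α| < k * (n * ε) := by
  obtain ⟨N, hN⟩ := hx ε hε
  refine ⟨N + 1, by omega, ?_⟩
  have h := hN (factorAt x 0 ((N + 1) * n)) (isFactor_factorAt _ _ _)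
    (by rw [length_factorAt]; nlinarith)
  have hc := count_factorAt x 0 ((N + 1) * n)
  have hc' : ((factorAt x 0 ((N + 1) * n)).count true : ℝ) = ones x 0 ((N + 1) * n) := by
    exact_mod_cast hc
  have hn' : (0 : ℝ) < n := by exact_mod_cast hn
  have hpos : (0 : ℝ) < ((N + 1 : ℕ) : ℝ) * n := by positivity
  rw [hc', length_factorAt, Nat.cast_mul] at h
  have e : (ones x 0 ((N + 1) * n) : ℝ) / (((N + 1 : ℕ) : ℝ) * n) - α =
      (ones x 0 ((N + 1) * n) - ((N + 1 : ℕ) : ℝ) * n * α) / (((N + 1 : ℕ) : ℝ) * n) := by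
    field_simp
  rw [e, abs_div, abs_of_pos hpos, div_lt_iff₀ hpos] at h
  linarith

/-- A factor of length `n` off by 1 or more would, by balance, put the counts of all factors of
length `n` on one side of `n α`, at a distance bounded below by irrationality. The frequency could
then not be `α`. -/
theorem IsSturmianOfSlope.lowDiscrepancy (hα : Irrational α) {x : Word}
    (hx : IsSturmianOfSlope α x) : LowDiscrepancy α x := by
  intro i n
  rcases Nat.eq_zero_or_pos n with rfl | hn
  · simp
  have hirr : ∀ c : ℤ, (c : ℝ) ≠ n * α := fun c h =>
    natCast_mul_ne_intCast hα (m := n) (by omega) c (by exact_mod_cast h.symm)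
  rw [abs_lt]
  constructor
  · by_contra hc
    have hlt : ((ones x i n + 1 : ℤ) : ℝ) < n * α :=
      lt_of_le_of_ne (by push_cast; linarith) (hirr _)
    obtain ⟨k, hk, hlk⟩ := hx.2.exists_abs_lt hn
      (ε := (n * α - (ones x i n + 1 : ℤ)) / n) (div_pos (by linarith) (by exact_mod_cast hn))
    have hle := ones_mul_le (c := ones x i n + 1) (fun j => hx.1.balanced n j i) k
    have hle' : (ones x 0 (k * n) : ℝ) ≤ k * (ones x i n + 1 : ℤ) := by exact_mod_cast hle
    have hn' : (n : ℝ) ≠ 0 := by positivity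
    rw [mul_div_cancel₀ _ hn'] at hlk
    have := (abs_lt.1 hlk).1
    linarith
  · by_contra hc
    have hlt : n * α < ((ones x i n - 1 : ℤ) : ℝ) :=
      lt_of_le_of_ne (by push_cast; linarith) (hirr _).symm
    obtain ⟨k, hk, hlk⟩ := hx.2.exists_abs_lt hn
      (ε := ((ones x i n - 1 : ℤ) - n * α) / n) (div_pos (by linarith) (by exact_mod_cast hn))
    have hle := le_ones_mul (c := ones x i n - 1)
      (fun j => by linarith [hx.1.balanced n i j]) k
    have hle' : (k : ℝ) * (ones x i n - 1 : ℤ) ≤ ones x 0 (k * n) := by exact_mod_cast hle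
    have hn' : (n : ℝ) ≠ 0 := by positivity
    rw [mul_div_cancel₀ _ hn'] at hlk
    have := (abs_lt.1 hlk).2
    linarith

/-! ### Rotation words and the characteristic word -/

/-- The letter that codes the point `t` for the rotation by `α`. -/
noncomputable def letter (α t : ℝ) : Bool := decide (⌊t + α⌋ ≠ ⌊t⌋)

theorem ite_letter (h0 : 0 < α) (h1 : α < 1) (t : ℝ) :
    (if letter α t then 1 else 0 : ℤ) = ⌊t + α⌋ - ⌊t⌋ := by
  have a : ⌊t⌋ ≤ ⌊t + α⌋ := Int.floor_le_floor (by linarith)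
  have b : ⌊t + α⌋ ≤ ⌊t⌋ + 1 := by
    rw [← Int.floor_add_one]; exact Int.floor_le_floor (by linarith)
  by_cases h : ⌊t + α⌋ = ⌊t⌋
  · simp [letter, h]
  · simp only [letter, ne_eq, h, not_false_eq_true, decide_true, if_true]
    omega

theorem letter_congr {s t : ℝ} {k : ℤ} (ha : ⌊s + α⌋ = ⌊t + α⌋ + k) (hb : ⌊s⌋ = ⌊t⌋ + k) :
    letter α s = letter α t := by
  simp [letter, ha, hb]

theorem letter_add_int (t : ℝ) (k : ℤ) : letter α (t + k) = letter α t :=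
  letter_congr (k := k) (by rw [add_right_comm, Int.floor_add_intCast]) (Int.floor_add_intCast t k)

theorem floor_neg_of_not_int {t : ℝ} (ht : ∀ k : ℤ, t ≠ k) : ⌊-t⌋ = -1 - ⌊t⌋ := by
  rw [Int.floor_eq_iff]
  have h1 := Int.lt_floor_add_one t
  have h2 := lt_of_le_of_ne (Int.floor_le t) (ht _).symm
  push_cast
  constructor <;> linarith

/-- The step from `t` to `t + α` is mapped by negation to the step from `-t - α` to `-t`; off the
integers, negation preserves whether an integer is crossed. -/
theorem letter_reflect {t : ℝ} (ht : ∀ k : ℤ, t ≠ k) (ht' : ∀ k : ℤ, t + α ≠ k) :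
    letter α (-t - α) = letter α t := by
  have a := floor_neg_of_not_int ht
  have b := floor_neg_of_not_int ht'
  have e1 : -t - α + α = -t := by ring
  have e2 : -t - α = -(t + α) := by ring
  have : ⌊-t - α + α⌋ = ⌊-t - α⌋ ↔ ⌊t + α⌋ = ⌊t⌋ := by
    rw [e1, e2, a, b]; omega
  rw [letter, letter, decide_eq_decide]
  exact not_congr this

theorem eventually_floor_eq {u : ℕ → ℝ} {t : ℝ} (hu : Tendsto u atTop (𝓝 t))
    (ht : ∀ k : ℤ, t ≠ k) : ∀ᶠ n in atTop, ⌊u n⌋ = ⌊t⌋ := by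
  have h : Set.Ioo (⌊t⌋ : ℝ) (⌊t⌋ + 1) ∈ 𝓝 t :=
    Ioo_mem_nhds (lt_of_le_of_ne (Int.floor_le t) (ht _).symm) (Int.lt_floor_add_one t)
  filter_upwards [hu h] with n hn
  exact Int.floor_eq_iff.2 ⟨hn.1.le, hn.2⟩

theorem eventually_letter_eq {u : ℕ → ℝ} {t : ℝ} (hu : Tendsto u atTop (𝓝 t))
    (ht : ∀ k : ℤ, t ≠ k) (ht' : ∀ k : ℤ, t + α ≠ k) :
    ∀ᶠ n in atTop, letter α (u n) = letter α t := by
  filter_upwards [eventually_floor_eq hu ht, eventually_floor_eq (hu.add_const α) ht'] with n a b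
  exact letter_congr (k := 0) (by simpa using b) (by simpa using a)

theorem ones_of_letter (h0 : 0 < α) (h1 : α < 1) {x : Word} {t : ℝ}
    (hx : ∀ n : ℕ, x n = letter α (t + n * α)) (i n : ℕ) :
    ones x i n = ⌊t + (i + n) * α⌋ - ⌊t + i * α⌋ := by
  induction n with
  | zero => simp
  | succ n ih =>
    rw [ones_succ, hx, ite_letter h0 h1, ih]
    have e : t + ((i + n : ℕ) : ℝ) * α + α = t + (i + (n + 1 : ℕ)) * α := by push_cast; ring
    rw [e]
    push_cast
    ring

theorem lowDiscrepancy_of_letter (h0 : 0 < α) (h1 : α < 1) {x : Word} {t : ℝ}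
    (hx : ∀ n : ℕ, x n = letter α (t + n * α)) : LowDiscrepancy α x := by
  intro i n
  rw [ones_of_letter h0 h1 hx]
  have a := Int.floor_le (t + i * α)
  have b := Int.lt_floor_add_one (t + i * α)
  have c := Int.floor_le (t + (i + n) * α)
  have d := Int.lt_floor_add_one (t + (i + n) * α)
  push_cast
  rw [abs_lt]
  constructor <;> linarith

theorem eq_of_ones_eq {x y : Word} (h : ∀ n, ones x 0 n = ones y 0 n) : x = y := by
  funext n
  have a := h n
  have b := h (n + 1)
  rw [ones_succ, ones_succ, a, zero_add] at b
  revert b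
  cases x n <;> cases y n <;> simp

/-- The characteristic word as a coding of a rotation. -/
noncomputable def charWord (α : ℝ) : Word := fun n => letter α ((n + 1) * α)

theorem charWord_apply (α : ℝ) (n : ℕ) : charWord α n = letter α (α + n * α) := by
  rw [charWord]; congr 1; ring

theorem charWord_lowDiscrepancy (h0 : 0 < α) (h1 : α < 1) : LowDiscrepancy α (charWord α) :=
  lowDiscrepancy_of_letter h0 h1 (charWord_apply α)

theorem ones_charWord (h0 : 0 < α) (h1 : α < 1) (n : ℕ) :
    ones (charWord α) 0 n = ⌊((n + 1 : ℕ) : ℝ) * α⌋ := by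
  have h : ⌊α⌋ = 0 := Int.floor_eq_zero_iff.2 ⟨h0.le, h1⟩
  have e : α + ((0 : ℕ) + (n : ℝ)) * α = ((n + 1 : ℕ) : ℝ) * α := by push_cast; ring
  rw [ones_of_letter h0 h1 (charWord_apply α), e]
  simp [h]

/-- The prefix of length `l` has `⌊(l + 1) α⌋` letters 1, so prepending either letter leaves the
count strictly within 1 of `(l + 1) α`. -/
theorem isAdmissible_cons_charWord (hα : Irrational α) (h0 : 0 < α) (h1 : α < 1) (b : Bool)
    (n : ℕ) : IsAdmissible α (b :: wordPrefix (charWord α) n) := by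
  intro i l hil
  rw [List.length_cons, wordPrefix, length_factorAt] at hil
  cases i with
  | zero =>
    cases l with
    | zero => simp
    | succ l =>
      rw [zero_add, List.take_succ_cons, wordPrefix, take_factorAt _ _ (by omega),
        List.take_zero, List.count_nil, List.count_cons, Nat.cast_add, count_factorAt,
        ones_charWord h0 h1]
      have c := Int.floor_le (((l + 1 : ℕ) : ℝ) * α)
      have d := Int.lt_floor_add_one (((l + 1 : ℕ) : ℝ) * α)
      have c' : (⌊((l + 1 : ℕ) : ℝ) * α⌋ : ℝ) ≠ ((l + 1 : ℕ) : ℝ) * α := fun h =>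
        natCast_mul_ne_intCast hα (m := (l + 1 : ℕ)) (by omega) _ (by rw [h]; rfl)
      have c'' := lt_of_le_of_ne c c'
      rw [abs_lt]
      push_cast at c'' d ⊢
      cases b <;> simp <;> constructor <;> linarith
  | succ i =>
    rw [show i + 1 + l = (i + l) + 1 by omega, List.take_succ_cons, List.take_succ_cons,
      List.count_cons, List.count_cons, wordPrefix, take_factorAt _ _ (by omega),
      take_factorAt _ _ (by omega), Nat.cast_add, Nat.cast_add, count_factorAt, count_factorAt,
      ones_add, zero_add]
    have := charWord_lowDiscrepancy h0 h1 i l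
    have e : ones (charWord α) 0 i + ones (charWord α) i l +
      ((if (b == true) = true then 1 else 0 : ℕ) : ℤ) - (ones (charWord α) 0 i + ((if (b == true) = true then 1 else 0 : ℕ) : ℤ)) =
        ones (charWord α) i l := by ring
    rw [e]
    exact this

theorem isCharacteristic_charWord (hα : Irrational α) (h0 : 0 < α) (h1 : α < 1) :
    IsCharacteristic α (charWord α) := by
  have h := charWord_lowDiscrepancy h0 h1
  refine ⟨charWord α, h.isSturmianOfSlope hα h0 h1, fun n _ => ⟨?_, ?_⟩⟩ <;>
  exact (h.isFactor_iff hα h0 h1 _).2 (isAdmissible_cons_charWord hα h0 h1 _ n)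

/-- Low discrepancy of both `0u` and `1u` pins the number of 1s in the prefix `u` of length `n` to
`⌊(n + 1) α⌋`. -/
theorem IsCharacteristic.eq_charWord (hα : Irrational α) (h0 : 0 < α) (h1 : α < 1) {c : Word}
    (hc : IsCharacteristic α c) : c = charWord α := by
  obtain ⟨x, hx, hs⟩ := hc
  refine eq_of_ones_eq fun n => ?_
  obtain ⟨hf, ht⟩ := hs (n + 1) (by omega)
  have a := IsAdmissible.of_isFactor (hx.lowDiscrepancy hα) hf 0 (n + 1) (by simp [wordPrefix])
  have b := IsAdmissible.of_isFactor (hx.lowDiscrepancy hα) ht 0 (n + 1) (by simp [wordPrefix])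
  rw [zero_add, List.take_succ_cons, wordPrefix, take_factorAt _ _ (by omega), List.take_zero,
    List.count_nil, List.count_cons, Nat.cast_add, count_factorAt] at a b
  simp at a b
  rw [abs_lt] at a b
  rw [ones_charWord h0 h1]
  symm
  rw [Int.floor_eq_iff]
  push_cast
  constructor <;> linarith

theorem characteristicWord_eq (hα : Irrational α) (h0 : 0 < α) (h1 : α < 1) :
    characteristicWord α = charWord α :=
  (Classical.epsilon_spec ⟨_, isCharacteristic_charWord hα h0 h1⟩ :
    IsCharacteristic α (characteristicWord α)).eq_charWord hα h0 h1

/-! ### Standard words are prefixes of the characteristic word -/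

/-- The letter at `j` involves the multiples `j + 1` and `j + 2` of `α`; both multipliers have to
stay below `q_{n+1}`. -/
theorem charWord_add_continuant (hα : Irrational α) (h0 : 0 < α) (h1 : α < 1) (n j : ℕ)
    (hj : j + 2 < continuant α (n + 1)) :
    charWord α (j + continuant α n) = charWord α j := by
  have a := floor_add_continuant hα h0 h1 n (j + 1) (by omega) (by omega)
  have b := floor_add_continuant hα h0 h1 n (j + 2) (by omega) hj
  refine letter_congr (k := convNum α n) ?_ ?_
  · rw [add_comm (convNum α n : ℤ)] at b
    convert b using 2
    · push_cast; ring
    · push_cast; ring_nf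
  · rw [add_comm (convNum α n : ℤ)] at a
    convert a using 2
    · push_cast; ring
    · push_cast; ring_nf

theorem factorAt_charWord_mul_add (hα : Irrational α) (h0 : 0 < α) (h1 : α < 1) (n b r : ℕ)
    (h : b * continuant α n + r + 1 < continuant α (n + 1) + continuant α n) :
    factorAt (charWord α) 0 (b * continuant α n + r) =
      (List.replicate b (factorAt (charWord α) 0 (continuant α n))).flatten ++
        factorAt (charWord α) 0 r := by
  induction b with
  | zero => simp
  | succ b ih =>
    have e : (b + 1) * continuant α n + r = continuant α n + (b * continuant α n + r) := by ring
    rw [e] at h ⊢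
    rw [factorAt_add, List.replicate_succ, List.flatten_cons, List.append_assoc, ← ih (by omega)]
    congr 1
    refine factorAt_eq_iff.2 fun k hk => ?_
    rw [zero_add, zero_add, add_comm, charWord_add_continuant hα h0 h1 n k (by omega)]

theorem floor_mul_eq_zero (hα : Irrational α) (h0 : 0 < α) (h1 : α < 1) (m : ℕ)
    (hm : m ≤ continuant α 1) : ⌊(m : ℝ) * α⌋ = 0 := by
  induction m with
  | zero => simp
  | succ m ih =>
    rcases Nat.eq_zero_or_pos m with rfl | hm0
    · exact Int.floor_eq_zero_iff.2 (by simp [h0.le, h1])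
    · have := floor_add_continuant hα h0 h1 0 m hm0 (by rw [zero_add]; omega)
      rw [ih (by omega)] at this
      simpa [continuant, convNum] using this

theorem charWord_eq_false (hα : Irrational α) (h0 : 0 < α) (h1 : α < 1) (j : ℕ)
    (hj : j + 2 ≤ continuant α 1) : charWord α j = false := by
  have a := floor_mul_eq_zero hα h0 h1 (j + 1) (by omega)
  have b := floor_mul_eq_zero hα h0 h1 (j + 2) hj
  have e : ((j : ℝ) + 1) * α + α = ((j + 2 : ℕ) : ℝ) * α := by push_cast; ring
  rw [charWord, letter, e, b]
  push_cast at a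
  simp [a]

theorem factorAt_charWord_replicate (hα : Irrational α) (h0 : 0 < α) (h1 : α < 1) (r : ℕ)
    (hr : r + 1 ≤ continuant α 1) :
    factorAt (charWord α) 0 r = List.replicate r false := by
  refine List.eq_replicate_iff.2 ⟨by simp, fun b hb => ?_⟩
  simp only [factorAt, List.mem_map, List.mem_range] at hb
  obtain ⟨j, hj, rfl⟩ := hb
  exact charWord_eq_false hα h0 h1 _ (by omega)

theorem charWord_last (hα : Irrational α) (h0 : 0 < α) (h1 : α < 1) :
    charWord α (continuant α 1 - 1) = true := by
  have hq := continuant_pos α 1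
  have a := floor_mul_eq_zero hα h0 h1 (continuant α 1) le_rfl
  have hq2 : 1 < continuant α 2 := by
    have := continuant_lt_succ α 0; simp only [zero_add] at this; omega
  have b := floor_add_continuant hα h0 h1 1 1 le_rfl hq2
  have c := floor_mul_eq_zero hα h0 h1 1 hq
  rw [c] at b
  have e1 : (((continuant α 1 - 1 : ℕ) : ℝ) + 1) * α = continuant α 1 * α := by
    rw [Nat.cast_sub hq]; push_cast; ring
  have e2 : (continuant α 1 : ℝ) * α + α = ((1 + continuant α 1 : ℕ) : ℝ) * α := by
    push_cast; ring
  rw [charWord, letter, e1, e2, a, b]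
  simp [convNum]

/-- The indices start at 1 because `s_0 = 0` is not a prefix when `a_1 = 1`. -/
theorem standardWord_eq (hα : Irrational α) (h0 : 0 < α) (h1 : α < 1) (n : ℕ) :
    standardWord α (n + 1) = factorAt (charWord α) 0 (continuant α (n + 1)) := by
  have hs1 : standardWord α 1 = factorAt (charWord α) 0 (continuant α 1) := by
    have hq := continuant_pos α 1
    conv_rhs => rw [show continuant α 1 = continuant α 1 - 1 + 1 by omega]
    rw [factorAt_succ, factorAt_charWord_replicate hα h0 h1 _ (by omega), zero_add,
      charWord_last hα h0 h1]
    rfl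
  induction n using Nat.strong_induction_on with
  | _ n ih =>
    match n with
    | 0 => exact hs1
    | 1 =>
      have hq := continuant_pos α 1
      have hrec : continuant α 2 = partQuot α 2 * continuant α 1 + 1 := rfl
      change (List.replicate (partQuot α 2) (standardWord α 1)).flatten ++ [false] =
        factorAt (charWord α) 0 (continuant α 2)
      rw [hs1]
      by_cases hq2 : 2 ≤ continuant α 1
      · rw [hrec, factorAt_charWord_mul_add hα h0 h1 1 _ _ (by
          rw [show continuant α (1 + 1) = _ from hrec]; omega)]
        congr 1
        simp [factorAt, charWord_eq_false hα h0 h1 0 hq2]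
      -- Here `a_1 = 1`, and the final letter 0 of `s_2` is not a prefix of the characteristic word.
      -- It is computed from `⌊q_2 α⌋ = ⌊(q_2 + 1) α⌋ = p_2`.
      · have hq1 : continuant α 1 = 1 := by omega
        have hp := factorAt_charWord_mul_add hα h0 h1 1 (partQuot α 2) 0 (by
          rw [show continuant α (1 + 1) = _ from hrec]; omega)
        rw [hrec, factorAt_succ]
        rw [add_zero] at hp
        rw [hp, zero_add]
        simp only [factorAt, List.range_zero, List.map_nil, List.append_nil]
        congr 1
        have f3 := floor_add_continuant hα h0 h1 2 1 le_rfl (by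
          have := continuant_lt_succ α 1
          have := continuant_lt_succ α 0
          simp only [zero_add] at this
          change 1 < continuant α 3
          change continuant α 2 < continuant α 3 at *
          omega)
        have c2 := convergent_sub hα h0 h1 2
        have g := gap_pos hα h0 3
        have g1 : gap α 3 < 1 := by
          have := gap_succ_lt hα h0 h1 0
          have := gap_anti hα h0 h1 (show 1 ≤ 3 by omega)
          rw [gap_zero, zero_add] at *
          linarith
        have f2 : ⌊(continuant α 2 : ℝ) * α⌋ = convNum α 2 := by
          rw [Int.floor_eq_iff]
          norm_num at c2
          push_cast
          constructor <;> linarith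
        have f1 : ⌊((1 : ℕ) : ℝ) * α⌋ = 0 := floor_mul_eq_zero hα h0 h1 1 hq
        have e1 : ((partQuot α 2 * continuant α 1 : ℕ) : ℝ) + 1 = continuant α 2 := by
          rw [hrec]; push_cast; ring
        have e2 : (continuant α 2 : ℝ) * α + α = ((1 + continuant α 2 : ℕ) : ℝ) * α := by
          push_cast; ring
        rw [charWord, letter, e1, e2, f3, f2, f1]
        simp
    | m + 2 =>
      have ha := ih (m + 1) (by omega)
      have hb := ih m (by omega)
      have hlt := continuant_lt_succ α m
      have hq := continuant_pos α (m + 1)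
      have hrec := continuant_rec α (m + 1)
      change (List.replicate (partQuot α (m + 3)) (standardWord α (m + 2))).flatten ++
        standardWord α (m + 1) = factorAt (charWord α) 0 (continuant α (m + 3))
      rw [ha, hb, show continuant α (m + 3) =
        partQuot α (m + 3) * continuant α (m + 2) + continuant α (m + 1) from rfl,
        factorAt_charWord_mul_add hα h0 h1]
      change partQuot α (m + 3) * continuant α (m + 2) + continuant α (m + 1) + 1 <
        continuant α (m + 3) + continuant α (m + 2)
      rw [show continuant α (m + 3) =
        partQuot α (m + 3) * continuant α (m + 2) + continuant α (m + 1) from rfl]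
      omega

/-! ### The words of given formal intercept -/

theorem shift_iterate (x : Word) (m i : ℕ) : shift^[m] x i = x (m + i) := by
  induction m generalizing i with
  | zero => simp
  | succ m ih => rw [Function.iterate_succ_apply', shift, ih]; congr 1; omega

theorem AlphaNumber.comp_zero (ρ : AlphaNumber α) : ρ.comp 0 = 0 := by
  have := ρ.lt 0
  simp only [continuant] at this
  omega

theorem AlphaNumber.comp_le_succ (ρ : AlphaNumber α) (n : ℕ) : ρ.comp n ≤ ρ.comp (n + 1) := by
  rw [ρ.comp_succ]; omega

theorem AlphaNumber.comp_mono (ρ : AlphaNumber α) : Monotone ρ.comp :=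
  monotone_nat_of_le_succ ρ.comp_le_succ

/-- Since `ρ_{n+1} < q_{n+1}`, the `b_{n+1}` successive shifts by `q_n` all stay in the range where
`q_n` acts as a period. So the first `q_n - 1` letters no longer change. -/
theorem AlphaNumber.charWord_succ (hα : Irrational α) (h0 : 0 < α) (h1 : α < 1)
    (ρ : AlphaNumber α) {n i : ℕ} (hi : i + 2 ≤ continuant α n) :
    charWord α (ρ.comp (n + 1) + i) = charWord α (ρ.comp n + i) := by
  have hlt := ρ.lt (n + 1)
  rw [ρ.comp_succ] at hlt ⊢
  have key : ∀ b ≤ ρ.digit n, charWord α (b * continuant α n + ρ.comp n + i) =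
      charWord α (ρ.comp n + i) := by
    intro b hb
    induction b with
    | zero => simp
    | succ b ih =>
      have : (b + 1) * continuant α n ≤ ρ.digit n * continuant α n := Nat.mul_le_mul_right _ hb
      rw [Nat.succ_mul] at this
      rw [← ih (by omega), ← charWord_add_continuant hα h0 h1 n (b * continuant α n + ρ.comp n + i)
        (by omega)]
      congr 1; ring
  exact key _ le_rfl

theorem AlphaNumber.charWord_comp (hα : Irrational α) (h0 : 0 < α) (h1 : α < 1)
    (ρ : AlphaNumber α) {n i : ℕ} (hi : i + 2 ≤ continuant α n) (k : ℕ) :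
    charWord α (ρ.comp (n + k) + i) = charWord α (ρ.comp n + i) := by
  induction k with
  | zero => rfl
  | succ k ih =>
    rw [← add_assoc, ρ.charWord_succ hα h0 h1 (hi.trans (continuant_mono α (by omega))), ih]

theorem AlphaNumber.exists_tendsto (hα : Irrational α) (h0 : 0 < α) (h1 : α < 1)
    (ρ : AlphaNumber α) : Tendsto (fun n => shift^[ρ.comp n] (characteristicWord α)) atTop
      (𝓝 fun i => charWord α (ρ.comp (i + 2) + i)) := by
  rw [characteristicWord_eq hα h0 h1, tendsto_pi_nhds]
  intro i
  refine tendsto_const_nhds.congr' ?_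
  filter_upwards [eventually_ge_atTop (i + 2)] with n hn
  obtain ⟨k, rfl⟩ := Nat.exists_eq_add_of_le hn
  rw [shift_iterate, ρ.charWord_comp hα h0 h1 (le_continuant α _)]

theorem AlphaNumber.tendsto_word (hα : Irrational α) (h0 : 0 < α) (h1 : α < 1)
    (ρ : AlphaNumber α) :
    Tendsto (fun n => shift^[ρ.comp n] (characteristicWord α)) atTop (𝓝 ρ.word) := by
  have h := ρ.exists_tendsto hα h0 h1
  rw [AlphaNumber.word, h.limUnder_eq]
  exact h

theorem AlphaNumber.word_apply (hα : Irrational α) (h0 : 0 < α) (h1 : α < 1)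
    (ρ : AlphaNumber α) {n i : ℕ} (hi : i + 2 ≤ continuant α n) :
    ρ.word i = charWord α (ρ.comp n + i) := by
  rw [AlphaNumber.word, (ρ.exists_tendsto hα h0 h1).limUnder_eq]
  change charWord α (ρ.comp (i + 2) + i) = _
  rw [← ρ.charWord_comp hα h0 h1 (le_continuant α (i + 2)) n, add_comm (i + 2),
    ρ.charWord_comp hα h0 h1 hi]

/-- This exposes the last reduction, modulo `q_n`, where the definition exposes the first;
compatibility of components is read from it. -/
theorem psi_succ (α : ℝ) (n d k : ℕ) : psi α n (d + 1) k = psi α (n + 1) d k % continuant α n := by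
  induction d generalizing k with
  | zero => rfl
  | succ d ih =>
    rw [psi, ih, psi, show n + (d + 1) = n + 1 + d by omega]

theorem psi_lt (α : ℝ) (n d k : ℕ) (hk : k < continuant α (n + d)) :
    psi α n d k < continuant α n := by
  cases d with
  | zero => exact hk
  | succ d => rw [psi_succ]; exact Nat.mod_lt _ (continuant_pos α n)

/-- An `α`-number is determined by a sequence of compatible components from some index on. -/
theorem AlphaNumber.exists_of_eventually (α : ℝ) (f : ℕ → ℕ) (N : ℕ)
    (hlt : ∀ n, N ≤ n → f n < continuant α n)
    (hc : ∀ n, N ≤ n → f n ≡ f (n + 1) [MOD continuant α n]) :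
    ∃ σ : AlphaNumber α, ∀ n, N ≤ n → σ.comp n = f n := by
  refine ⟨⟨fun n => if N ≤ n then f n else psi α n (N - n) (f N), fun n => ?_, fun n => ?_⟩,
    fun n hn => if_pos hn⟩
  · split_ifs with h
    · exact hlt n h
    · exact psi_lt _ _ _ _ (by rw [Nat.add_sub_cancel' (by omega)]; exact hlt N le_rfl)
  · rcases lt_trichotomy N (n + 1) with h | h | h
    · rw [if_pos (by omega), if_pos (by omega)]
      exact hc n (by omega)
    · rw [if_neg (by omega), if_pos (by omega), h, Nat.add_sub_cancel_left, psi_succ]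
      exact Nat.mod_modEq _ _
    · rw [if_neg (by omega), if_neg (by omega), show N - n = N - (n + 1) + 1 by omega, psi_succ]
      exact Nat.mod_modEq _ _

theorem exists_word_eq_shift (hα : Irrational α) (h0 : 0 < α) (h1 : α < 1) (l : ℕ) :
    ∃ σ : AlphaNumber α, σ.word = shift^[l] (charWord α) := by
  obtain ⟨σ, hσ⟩ := AlphaNumber.exists_of_eventually α (fun _ => l) (l + 1)
    (fun n hn => lt_of_lt_of_le hn (le_continuant α n)) (fun _ _ => rfl)
  refine ⟨σ, funext fun i => ?_⟩
  rw [σ.word_apply hα h0 h1 (n := l + 1 + (i + 2))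
    (le_trans (by omega) (le_continuant α _)), hσ _ (by omega), shift_iterate]

theorem zero_word (hα : Irrational α) (h0 : 0 < α) (h1 : α < 1) :
    (0 : AlphaNumber α).word = charWord α := by
  funext i
  rw [(0 : AlphaNumber α).word_apply hα h0 h1 (n := i + 2) (le_continuant α _)]
  change charWord α (0 + i) = _
  rw [zero_add]

/-- Each word of low discrepancy has a formal intercept. -/
theorem LowDiscrepancy.exists_word_eq (hα : Irrational α) (h0 : 0 < α) (h1 : α < 1) {x : Word}
    (hx : LowDiscrepancy α x) : ∃ ρ : AlphaNumber α, x = ρ.word := by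
  have hσ : ∀ N, ∃ σ : AlphaNumber α, ∀ i < N, x i = σ.word i := by
    intro N
    obtain ⟨m, hm⟩ := ((charWord_lowDiscrepancy h0 h1).isFactor_iff hα h0 h1 _).2
      ((hx.isFactor_iff hα h0 h1 _).1 (isFactor_factorAt x 0 N))
    obtain ⟨σ, hs⟩ := exists_word_eq_shift hα h0 h1 m
    refine ⟨σ, fun i hi => ?_⟩
    rw [length_factorAt] at hm
    have := factorAt_eq_iff.1 hm i hi
    rw [hs, shift_iterate, ← this, zero_add]
  choose σ hσ using hσ
  -- Compactness: each component takes finitely many values, hence is constant along an ultrafilter.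
  have hr : ∀ n, ∃ r, ∀ᶠ N in (hyperfilter ℕ : Filter ℕ), (σ N).comp n = r := by
    intro n
    have : ∀ᶠ N in (hyperfilter ℕ : Filter ℕ), ∃ r ∈ Set.Iio (continuant α n),
        (σ N).comp n = r := Eventually.of_forall fun N => ⟨_, (σ N).lt n, rfl⟩
    obtain ⟨r, -, h⟩ := (Ultrafilter.eventually_exists_mem_iff (Set.finite_Iio _)).1 this
    exact ⟨r, h⟩
  choose r hr using hr
  refine ⟨⟨r, fun n => ?_, fun n => ?_⟩, funext fun i => ?_⟩
  · obtain ⟨N, hN⟩ := (hr n).exists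
    rw [← hN]; exact (σ N).lt n
  · obtain ⟨N, hN, hN'⟩ := ((hr n).and (hr (n + 1))).exists
    rw [← hN, ← hN']; exact (σ N).compat n
  · have hgt : ∀ᶠ N in (hyperfilter ℕ : Filter ℕ), i < N := by
      refine Filter.Eventually.filter_mono (Nat.hyperfilter_le_atTop) (eventually_gt_atTop i)
    obtain ⟨N, hN, hN'⟩ := ((hr (i + 2)).and hgt).exists
    rw [hσ N i hN', (σ N).word_apply hα h0 h1 (le_continuant α (i + 2)), hN,
      AlphaNumber.word_apply hα h0 h1 _ (le_continuant α (i + 2))]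

/-! ### Products of reversed standard words -/

/-- By near periodicity the prefix of length `b q_N + ρ_N` is `s_N^b` followed by the prefix of
length `ρ_N`; reversal puts the new factors at the end. The factor `s_0` is treated apart. -/
theorem AlphaNumber.finProd_eq (hα : Irrational α) (h0 : 0 < α) (h1 : α < 1)
    (ρ : AlphaNumber α) (N : ℕ) :
    ρ.finProd N = (factorAt (charWord α) 0 (ρ.comp N)).reverse := by
  induction N with
  | zero => simp [finProd, ρ.comp_zero, factorAt]
  | succ N ih =>
    cases N with
    | zero =>
      have h : ρ.comp 1 = ρ.digit 0 := by
        rw [ρ.comp_succ, ρ.comp_zero]; simp [continuant]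
      rw [zero_add, factorAt_charWord_replicate hα h0 h1 _ (ρ.lt 1), h]
      simp [finProd, standardWord]
    | succ N =>
      have hlt := ρ.lt (N + 1 + 1)
      have hq := continuant_pos α (N + 1)
      rw [finProd, ih, standardWord_eq hα h0 h1]
      rw [ρ.comp_succ (N + 1)] at hlt ⊢
      rw [factorAt_charWord_mul_add hα h0 h1 _ _ _ (by omega), List.reverse_append,
        List.reverse_flatten]
      simp

theorem AlphaNumber.length_finProd (hα : Irrational α) (h0 : 0 < α) (h1 : α < 1)
    (ρ : AlphaNumber α) (N : ℕ) : (ρ.finProd N).length = ρ.comp N := by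
  simp [ρ.finProd_eq hα h0 h1]

theorem AlphaNumber.finProd_prefix_of_le (ρ : AlphaNumber α) {M N : ℕ} (h : M ≤ N) :
    ρ.finProd M <+: ρ.finProd N := by
  induction N, h using Nat.le_induction with
  | base => exact List.prefix_rfl
  | succ N _ ih => exact ih.trans (ρ.finProd_prefix N)

theorem AlphaNumber.infProd_apply (hα : Irrational α) (h0 : 0 < α) (h1 : α < 1)
    (ρ : AlphaNumber α) {i N : ℕ} (hi : i < ρ.comp N) :
    ρ.infProd i = charWord α (ρ.comp N - 1 - i) := by
  classical
  have hN : i < (ρ.finProd N).length := by rwa [ρ.length_finProd hα h0 h1]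
  have h : ∃ N, i < (ρ.finProd N).length := ⟨N, hN⟩
  have e : ρ.infProd i = (ρ.finProd (Nat.find h))[i]'(Nat.find_spec h) := by
    rw [infProd, dif_pos h]
  rw [e, (ρ.finProd_prefix_of_le (Nat.find_min' h hN)).getElem]
  simp [ρ.finProd_eq hα h0 h1, factorAt]

/-! ### The point of the circle attached to an α-number -/

/-- `∑_{i < n} b_{i+1} p_i`. -/
noncomputable def AlphaNumber.num (ρ : AlphaNumber α) (n : ℕ) : ℕ :=
  ∑ i ∈ Finset.range n, ρ.digit i * convNum α i

/-- The partial sums `∑_{i < n} b_{i+1} (q_i α - p_i)`. -/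
noncomputable def AlphaNumber.approx (ρ : AlphaNumber α) (n : ℕ) : ℝ := ρ.comp n * α - ρ.num n

/-- The sum `∑_{i ≥ 0} b_{i+1} (q_i α - p_i)`. -/
noncomputable def AlphaNumber.angle (ρ : AlphaNumber α) : ℝ := limUnder atTop ρ.approx

/-- The real number `t` belongs to `ℤ α + ℤ`. -/
def InOrbit (α t : ℝ) : Prop := ∃ m k : ℤ, t = m * α + k

theorem InOrbit.sub {s t : ℝ} (hs : InOrbit α s) (ht : InOrbit α t) : InOrbit α (s - t) := by
  obtain ⟨m, k, rfl⟩ := hs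
  obtain ⟨m', k', rfl⟩ := ht
  exact ⟨m - m', k - k', by push_cast; ring⟩

theorem InOrbit.add {s t : ℝ} (hs : InOrbit α s) (ht : InOrbit α t) : InOrbit α (s + t) := by
  obtain ⟨m, k, rfl⟩ := hs
  obtain ⟨m', k', rfl⟩ := ht
  exact ⟨m + m', k + k', by push_cast; ring⟩

theorem inOrbit_int (k : ℤ) : InOrbit α k := ⟨0, k, by simp⟩

theorem inOrbit_int_mul (m : ℤ) : InOrbit α (m * α) := ⟨m, 0, by simp⟩

theorem AlphaNumber.inOrbit_approx (ρ : AlphaNumber α) (n : ℕ) : InOrbit α (ρ.approx n) :=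
  ⟨ρ.comp n, -ρ.num n, by rw [approx]; push_cast; ring⟩

theorem not_int_of_not_inOrbit {t : ℝ} (ht : ¬ InOrbit α t) (m : ℤ) (k : ℤ) : t + m * α ≠ k :=
  fun h => ht ⟨-m, k, by push_cast; linarith⟩

theorem AlphaNumber.approx_succ (hα : Irrational α) (h0 : 0 < α) (h1 : α < 1)
    (ρ : AlphaNumber α) (n : ℕ) :
    ρ.approx (n + 1) = ρ.approx n + ρ.digit n * ((-1) ^ n * gap α (n + 1)) := by
  rw [← convergent_sub hα h0 h1, approx, approx, ρ.comp_succ, num, Finset.sum_range_succ, num]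
  push_cast
  ring

/-! ### Ostrowski digit conditions, tail estimates and uniqueness of the expansion -/

theorem AlphaNumber.digit_le (ρ : AlphaNumber α) (n : ℕ) : ρ.digit n ≤ partQuot α (n + 1) := by
  have h := ρ.lt (n + 1)
  rw [ρ.comp_succ] at h
  cases n with
  | zero => simp [continuant] at h ⊢; omega
  | succ n =>
    rw [continuant_rec] at h
    by_contra hc
    have h2 : (partQuot α (n + 1 + 1) + 1) * continuant α (n + 1) ≤
      ρ.digit (n + 1) * continuant α (n + 1) := Nat.mul_le_mul_right _ (by omega)
    have := continuant_le_succ α n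
    rw [Nat.succ_mul] at h2
    change _ < partQuot α (n + 1 + 1) * _ + _ at h
    omega

/-- The Ostrowski condition: a maximal digit must be preceded by 0, since otherwise `ρ_{n+1} ≥ q_n`
and `ρ_{n+2}` would reach `q_{n+2}`. -/
theorem AlphaNumber.digit_lt (ρ : AlphaNumber α) {n : ℕ} (hn : ρ.digit n ≠ 0) :
    ρ.digit (n + 1) < partQuot α (n + 2) := by
  have h := ρ.lt (n + 2)
  rw [ρ.comp_succ, continuant_rec] at h
  have h3 := ρ.comp_succ n
  have h4 : continuant α n ≤ ρ.digit n * continuant α n :=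
    Nat.le_mul_of_pos_left _ (by omega)
  by_contra hc
  have h2 : partQuot α (n + 2) * continuant α (n + 1) ≤
    ρ.digit (n + 1) * continuant α (n + 1) := Nat.mul_le_mul_right _ (by omega)
  omega

/-- Bounds for the tails of the series that defines the angle. -/
theorem AlphaNumber.tail_bounds (hα : Irrational α) (h0 : 0 < α) (h1 : α < 1)
    (ρ : AlphaNumber α) (k n : ℕ) :
    -gap α (n + 1) ≤ (-1) ^ n * (ρ.approx (n + k) - ρ.approx n) ∧
      (-1) ^ n * (ρ.approx (n + k) - ρ.approx n) ≤ gap α n := by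
  induction k generalizing n with
  | zero => simp [(gap_pos hα h0 _).le]
  | succ k ih =>
    obtain ⟨hl, hu⟩ := ih (n + 1)
    have g := gap_rec hα h0 h1 n
    have g1 := gap_pos hα h0 (n + 1)
    have g2 := gap_pos hα h0 (n + 2)
    have hlt := gap_succ_lt hα h0 h1 (n + 1)
    have hsq : ((-1 : ℝ) ^ n) * (-1) ^ n = 1 := by rw [← mul_pow]; simp
    -- Splitting off the leading digit flips the sign, so each bound follows from the opposite bound
    -- at `n + 1`.
    have e : (-1) ^ n * (ρ.approx (n + (k + 1)) - ρ.approx n) = ρ.digit n * gap α (n + 1) -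
        (-1) ^ (n + 1) * (ρ.approx (n + 1 + k) - ρ.approx (n + 1)) := by
      rw [show n + (k + 1) = n + 1 + k by omega, ρ.approx_succ hα h0 h1 n, pow_succ]
      linear_combination (ρ.digit n * gap α (n + 1) : ℝ) * hsq
    have hb : (ρ.digit n : ℝ) ≤ partQuot α (n + 1) := by exact_mod_cast ρ.digit_le n
    have hb0 : (0 : ℝ) ≤ ρ.digit n := Nat.cast_nonneg _
    rw [e]
    constructor <;> nlinarith

/-- After a nonzero digit the next one is not maximal, which improves the upper bound by `gap α (n +
2)`. This makes the two-sided estimate decisive in the proof of uniqueness. -/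
theorem AlphaNumber.tail_le (hα : Irrational α) (h0 : 0 < α) (h1 : α < 1)
    (ρ : AlphaNumber α) (k n : ℕ) (hn : ρ.digit n ≠ 0) :
    (-1) ^ (n + 1) * (ρ.approx (n + 1 + k) - ρ.approx (n + 1)) ≤
      gap α (n + 1) - gap α (n + 2) := by
  have g := gap_rec hα h0 h1 (n + 1)
  have hle := gap_add_le hα h0 h1 (n + 1)
  have g1 := gap_pos hα h0 (n + 2)
  cases k with
  | zero => simpa using (gap_anti hα h0 h1 (Nat.le_succ (n + 1)))
  | succ k =>
    obtain ⟨hl, hu⟩ := ρ.tail_bounds hα h0 h1 k (n + 2)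
    have hsq : ((-1 : ℝ) ^ n) * (-1) ^ n = 1 := by rw [← mul_pow]; simp
    have e : (-1) ^ (n + 1) * (ρ.approx (n + 1 + (k + 1)) - ρ.approx (n + 1)) =
        ρ.digit (n + 1) * gap α (n + 2) -
        (-1) ^ (n + 2) * (ρ.approx (n + 2 + k) - ρ.approx (n + 2)) := by
      rw [show n + 1 + (k + 1) = n + 2 + k by omega, ρ.approx_succ hα h0 h1 (n + 1), pow_succ,
        pow_add]
      linear_combination (ρ.digit (n + 1) * gap α (n + 2) : ℝ) * hsq
    have hb : (ρ.digit (n + 1) : ℝ) + 1 ≤ partQuot α (n + 2) := by exact_mod_cast ρ.digit_lt hn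
    rw [e]
    nlinarith

theorem AlphaNumber.tendsto_approx (hα : Irrational α) (h0 : 0 < α) (h1 : α < 1)
    (ρ : AlphaNumber α) : Tendsto ρ.approx atTop (𝓝 ρ.angle) := by
  have hc : CauchySeq ρ.approx := by
    refine cauchySeq_of_le_tendsto_0 (fun N => gap α N + gap α N) (fun n m N hn hm => ?_) ?_
    · have key : ∀ n, N ≤ n → dist (ρ.approx n) (ρ.approx N) ≤ gap α N := by
        intro n hn
        obtain ⟨k, rfl⟩ := Nat.exists_eq_add_of_le hn
        obtain ⟨hl, hu⟩ := ρ.tail_bounds hα h0 h1 k N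
        have := gap_succ_lt hα h0 h1 N
        have e : dist (ρ.approx (N + k)) (ρ.approx N) =
            |(-1) ^ N * (ρ.approx (N + k) - ρ.approx N)| := by
          rw [Real.dist_eq]; simp [abs_mul]
        rw [e, abs_le]
        constructor <;> linarith
      exact (dist_triangle_right _ _ _).trans (add_le_add (key n hn) (key m hm))
    · simpa using (gap_tendsto hα h0 h1).add (gap_tendsto hα h0 h1)
  exact hc.tendsto_limUnder

theorem AlphaNumber.tendsto_tail (hα : Irrational α) (h0 : 0 < α) (h1 : α < 1)
    (ρ : AlphaNumber α) (n : ℕ) :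
    Tendsto (fun k => (-1) ^ n * (ρ.approx (n + k) - ρ.approx n)) atTop
      (𝓝 ((-1) ^ n * (ρ.angle - ρ.approx n))) := by
  have h := (tendsto_add_atTop_iff_nat n).2 (ρ.tendsto_approx hα h0 h1)
  simp_rw [add_comm n]
  exact (h.sub_const _).const_mul _

theorem AlphaNumber.angle_bounds (hα : Irrational α) (h0 : 0 < α) (h1 : α < 1)
    (ρ : AlphaNumber α) (n : ℕ) :
    -gap α (n + 1) ≤ (-1) ^ n * (ρ.angle - ρ.approx n) ∧
      (-1) ^ n * (ρ.angle - ρ.approx n) ≤ gap α n :=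
  ⟨ge_of_tendsto' (ρ.tendsto_tail hα h0 h1 n) fun k => (ρ.tail_bounds hα h0 h1 k n).1,
    le_of_tendsto' (ρ.tendsto_tail hα h0 h1 n) fun k => (ρ.tail_bounds hα h0 h1 k n).2⟩

theorem AlphaNumber.angle_le (hα : Irrational α) (h0 : 0 < α) (h1 : α < 1)
    (ρ : AlphaNumber α) {n : ℕ} (hn : ρ.digit n ≠ 0) :
    (-1) ^ (n + 1) * (ρ.angle - ρ.approx (n + 1)) ≤ gap α (n + 1) - gap α (n + 2) :=
  le_of_tendsto' (ρ.tendsto_tail hα h0 h1 (n + 1)) fun k => ρ.tail_le hα h0 h1 k n hn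

theorem AlphaNumber.angle_lower_ne (hα : Irrational α) (h0 : 0 < α) (h1 : α < 1)
    (ρ : AlphaNumber α) (hρ : ¬ InOrbit α ρ.angle) (n : ℕ) :
    (-1) ^ n * (ρ.angle - ρ.approx n) ≠ -gap α (n + 1) := by
  intro h
  have c := convergent_sub hα h0 h1 n
  have hsq : ((-1 : ℝ) ^ n) * (-1) ^ n = 1 := by rw [← mul_pow]; simp
  apply hρ
  have e : ρ.angle = ρ.approx n - ((continuant α n : ℤ) * α - (convNum α n : ℤ)) := by
    push_cast
    linear_combination (-1) ^ n * h - (ρ.angle - ρ.approx n) * hsq + c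
  rw [e]
  exact (ρ.inOrbit_approx n).sub ((inOrbit_int_mul _).sub (inOrbit_int _))

/-- Uniqueness of the Ostrowski expansion. -/
theorem AlphaNumber.eq_of_angle_sub_int (hα : Irrational α) (h0 : 0 < α) (h1 : α < 1)
    {ρ σ : AlphaNumber α} (hρ : ¬ InOrbit α ρ.angle) {k : ℤ} (h : ρ.angle - σ.angle = k) :
    ρ = σ := by
  have hσ : ¬ InOrbit α σ.angle := fun hc =>
    hρ (by rw [show ρ.angle = σ.angle + k by linarith]; exact hc.add (inOrbit_int k))
  refine AlphaNumber.ext (funext fun n => ?_)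
  by_contra hne
  wlog hlt : σ.comp n < ρ.comp n generalizing ρ σ k
  · exact this (k := -k) hσ (by push_cast; linarith) hρ (Ne.symm hne) (by omega)
  cases n with
  | zero => rw [ρ.comp_zero] at hlt; omega
  | succ m =>
    obtain ⟨l1, u1⟩ := ρ.angle_bounds hα h0 h1 (m + 1)
    obtain ⟨l2, u2⟩ := σ.angle_bounds hα h0 h1 (m + 1)
    have l1' := lt_of_le_of_ne l1 (ρ.angle_lower_ne hα h0 h1 hρ (m + 1)).symm
    have l2' := lt_of_le_of_ne l2 (σ.angle_lower_ne hα h0 h1 hσ (m + 1)).symm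
    -- The difference of the components, times `α`, equals modulo 1 a difference of two small tails;
    -- best approximation shows that it cannot be so small.
    have e : (-1 : ℝ) ^ (m + 1) * (((ρ.comp (m + 1) - σ.comp (m + 1) : ℕ) : ℝ) * α -
        ((ρ.num (m + 1) - σ.num (m + 1) + k : ℤ) : ℝ)) =
        (-1) ^ (m + 1) * (σ.angle - σ.approx (m + 1)) -
          (-1) ^ (m + 1) * (ρ.angle - ρ.approx (m + 1)) := by
      rw [Nat.cast_sub hlt.le, approx, approx]
      push_cast
      rw [← h]
      ring
    -- If this digit of the larger component is 0, the difference is below `q_m` and the one-sided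
    -- tail bounds suffice. Otherwise it is only below `q_{m+1}`, and the improved bound `angle_le`
    -- is needed.
    by_cases hd : ρ.digit m = 0
    · have hc := ρ.comp_succ m
      rw [hd, zero_mul, zero_add] at hc
      have hb := ρ.lt m
      cases m with
      | zero => rw [zero_add] at *; rw [ρ.comp_zero] at hc; omega
      | succ l =>
        have hg := gap_le_of_lt_continuant hα h0 h1 l (ρ.comp (l + 1 + 1) - σ.comp (l + 1 + 1))
          (ρ.num (l + 1 + 1) - σ.num (l + 1 + 1) + k) (by omega) (by omega)
        have hle := gap_add_le hα h0 h1 (l + 1)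
        have e2 : ∀ v : ℝ, |v| = |(-1) ^ (l + 1 + 1) * v| := fun v => by simp [abs_mul]
        rw [e2, e] at hg
        have : |(-1) ^ (l + 1 + 1) * (σ.angle - σ.approx (l + 1 + 1)) -
          (-1) ^ (l + 1 + 1) * (ρ.angle - ρ.approx (l + 1 + 1))| < gap α (l + 1) := by
          rw [abs_lt]
          constructor <;> linarith
        linarith
    · have u3 := ρ.angle_le hα h0 h1 hd
      have hb := ρ.lt (m + 1)
      have hg := gap_le_or_le_of_lt_continuant hα h0 h1 m (ρ.comp (m + 1) - σ.comp (m + 1))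
        (ρ.num (m + 1) - σ.num (m + 1) + k) (by omega) (by omega)
      have e3 : ∀ v : ℝ, (-1 : ℝ) ^ m * v = -((-1) ^ (m + 1) * v) := fun v => by
        rw [pow_succ]; ring
      rw [e3, e] at hg
      rcases hg with hg | hg <;> linarith

/-! ### Forward and backward codings from the angle -/

theorem exists_int_of_letter_eq (hα : Irrational α) (h0 : 0 < α) (h1 : α < 1) {s t : ℝ}
    (h : ∀ i : ℕ, letter α (s + i * α) = letter α (t + i * α)) : ∃ k : ℤ, s - t = k := by
  refine exists_int_of_floor_sub (fun i : ℕ => i * α)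
    (fun t ε hε => (exists_mul_add_mem_Ioo hα h0 h1 t ε hε).1) s t (⌊s⌋ - ⌊t⌋) fun i => ?_
  induction i with
  | zero => simp
  | succ i ih =>
    have a := ite_letter h0 h1 (s + i * α)
    have b := ite_letter h0 h1 (t + i * α)
    rw [h i, b] at a
    have e : ∀ r : ℝ, r + ((i + 1 : ℕ) : ℝ) * α = r + i * α + α := fun r => by push_cast; ring
    rw [e, e]
    omega

theorem exists_int_of_letter_eq_neg (hα : Irrational α) (h0 : 0 < α) (h1 : α < 1) {s t : ℝ}
    (h : ∀ i : ℕ, letter α (s - i * α) = letter α (t - i * α)) : ∃ k : ℤ, s - t = k := by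
  have key : ∀ i : ℕ, ⌊s + α + -(i * α)⌋ - ⌊t + α + -(i * α)⌋ = ⌊s + α⌋ - ⌊t + α⌋ := by
    intro i
    induction i with
    | zero => simp
    | succ i ih =>
      have a := ite_letter h0 h1 (s - i * α)
      have b := ite_letter h0 h1 (t - i * α)
      rw [h i, b] at a
      have e : ∀ r : ℝ, r + α + -(((i + 1 : ℕ) : ℝ) * α) = r - i * α := fun r => by
        push_cast; ring
      have e' : ∀ r : ℝ, r - i * α + α = r + α + -(i * α) := fun r => by ring
      rw [e, e]
      rw [e', e'] at a
      omega
  obtain ⟨k, hk⟩ := exists_int_of_floor_sub (fun i : ℕ => -(i * α))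
    (fun t ε hε => (exists_mul_add_mem_Ioo hα h0 h1 t ε hε).2) _ _ _ key
  exact ⟨k, by linarith⟩

/-- The word of formal intercept `ρ` is a coding of the rotation, starting at its angle. -/
theorem AlphaNumber.word_eq_letter (hα : Irrational α) (h0 : 0 < α) (h1 : α < 1)
    (ρ : AlphaNumber α) {i : ℕ} (hi : ∀ k : ℤ, ρ.angle + (i + 1) * α ≠ k)
    (hi' : ∀ k : ℤ, ρ.angle + (i + 1) * α + α ≠ k) :
    ρ.word i = letter α (ρ.angle + (i + 1) * α) := by
  have h := eventually_letter_eq ((ρ.tendsto_approx hα h0 h1).add_const ((i + 1) * α)) hi hi'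
  obtain ⟨n, hn, hni⟩ := (h.and (eventually_ge_atTop (i + 2))).exists
  rw [← hn, ρ.word_apply hα h0 h1 (hni.trans (le_continuant α n)), charWord,
    ← letter_add_int _ (-ρ.num n : ℤ)]
  congr 1
  rw [approx]
  push_cast
  ring

theorem AlphaNumber.word_eq_letter_of_not_inOrbit (hα : Irrational α) (h0 : 0 < α) (h1 : α < 1)
    (ρ : AlphaNumber α) (hρ : ¬ InOrbit α ρ.angle) (i : ℕ) :
    ρ.word i = letter α (ρ.angle + (i + 1) * α) := by
  refine ρ.word_eq_letter hα h0 h1 (fun k => ?_) fun k => ?_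
  · exact_mod_cast not_int_of_not_inOrbit hρ (i + 1) k
  · have := not_int_of_not_inOrbit hρ (i + 2) k
    push_cast at this
    convert this using 1
    ring

theorem AlphaNumber.comp_unbounded (ρ : AlphaNumber α) (hα : Irrational α) (h0 : 0 < α)
    (h1 : α < 1) (hρ : ¬ InOrbit α ρ.angle) : Tendsto ρ.comp atTop atTop := by
  refine tendsto_atTop_atTop_of_monotone ρ.comp_mono fun B => ?_
  by_contra hcon
  push Not at hcon
  have hd : ∀ n, B ≤ n → ρ.digit n = 0 := by
    intro n hn
    by_contra hne
    have := hcon (n + 1)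
    rw [ρ.comp_succ] at this
    have h2 := Nat.le_mul_of_pos_left (continuant α n) (Nat.pos_of_ne_zero hne)
    have := le_continuant α n
    omega
  have hc : ∀ k, ρ.approx (B + k) = ρ.approx B := by
    intro k
    induction k with
    | zero => rfl
    | succ k ih => rw [← add_assoc, ρ.approx_succ hα h0 h1, hd _ (by omega), ih]; simp
  have hl : ρ.angle = ρ.approx B := by
    refine tendsto_nhds_unique (ρ.tendsto_approx hα h0 h1) (tendsto_const_nhds.congr' ?_)
    filter_upwards [eventually_ge_atTop B] with n hn
    obtain ⟨k, rfl⟩ := Nat.exists_eq_add_of_le hn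
    exact (hc k).symm
  exact hρ (hl ▸ ρ.inOrbit_approx B)

/-- For large `n` the letter is the one of `c_α` at `ρ_n - 1 - i`, which codes `ρ_n α - i α`. The
coding is locally constant at the limit point. -/
theorem AlphaNumber.infProd_eq_letter (hα : Irrational α) (h0 : 0 < α) (h1 : α < 1)
    (ρ : AlphaNumber α) (hρ : ¬ InOrbit α ρ.angle) (i : ℕ) :
    ρ.infProd i = letter α (ρ.angle - i * α) := by
  have hi : ∀ k : ℤ, ρ.angle - i * α ≠ k := fun k => by
    have := not_int_of_not_inOrbit hρ (-i) k
    push_cast at this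
    rwa [neg_mul, ← sub_eq_add_neg] at this
  have hi' : ∀ k : ℤ, ρ.angle - i * α + α ≠ k := fun k => by
    have := not_int_of_not_inOrbit hρ (1 - i) k
    push_cast at this
    convert this using 1
    ring
  have h := eventually_letter_eq ((ρ.tendsto_approx hα h0 h1).sub_const (i * α)) hi hi'
  obtain ⟨n, hn, hni⟩ :=
    (h.and ((ρ.comp_unbounded hα h0 h1 hρ).eventually_gt_atTop i)).exists
  rw [← hn, ρ.infProd_apply hα h0 h1 hni, charWord, ← letter_add_int _ (-ρ.num n : ℤ)]
  congr 1
  rw [approx, Nat.cast_sub (by omega), Nat.cast_sub (by omega)]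
  push_cast
  ring

/-- The equivalence class of `ρ` is non-zero if and only if its angle is not in `ℤ α + ℤ`. -/
theorem AlphaNumber.nonzeroClass_iff (hα : Irrational α) (h0 : 0 < α) (h1 : α < 1)
    (ρ : AlphaNumber α) : ρ.NonzeroClass ↔ ¬ InOrbit α ρ.angle := by
  refine not_congr ⟨?_, ?_⟩
  · rintro ⟨k, l, σ, h, h'⟩
    by_contra hρ
    rw [IsAdd, zero_word hα h0 h1] at h'
    rw [IsAdd, h'] at h
    obtain ⟨z, hz⟩ := exists_int_of_letter_eq hα h0 h1 (s := ρ.angle + (k + 1) * α)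
      (t := (l + 1) * α) fun i => by
        have := congrFun h i
        rw [shift_iterate, shift_iterate, ρ.word_eq_letter_of_not_inOrbit hα h0 h1 hρ,
          charWord] at this
        convert this.symm using 2 <;> push_cast <;> ring
    exact hρ ⟨l - k, z, by push_cast; linarith⟩
  · rintro ⟨m, k, hm⟩
    -- Shifting by `a ≥ -m` leaves only positive multiples of `α` modulo 1, beyond the
    -- discontinuities where the coding by the angle may fail.
    obtain ⟨a, l, hl⟩ : ∃ a l : ℕ, (a : ℤ) + m = l :=
      ⟨m.natAbs, (m.natAbs + m).toNat, by omega⟩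
    obtain ⟨σ, hσ⟩ := exists_word_eq_shift hα h0 h1 l
    refine ⟨a, l, σ, ?_, ?_⟩
    · rw [IsAdd, hσ]
      funext i
      rw [shift_iterate, shift_iterate]
      have hl' : (l : ℝ) = a + m := by exact_mod_cast hl.symm
      have hne : ∀ z : ℤ, ∀ j : ℕ, ((l + i + 1 + j : ℕ) : ℝ) * α ≠ z := fun z j =>
        by exact_mod_cast natCast_mul_ne_intCast hα (m := ((l + i + 1 + j : ℕ) : ℤ)) (by omega) z
      have e : ρ.angle + (((a + i : ℕ) : ℝ) + 1) * α =
          ((l + i : ℕ) + 1) * α + k := by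
        rw [hm]; push_cast; rw [hl']; ring
      rw [ρ.word_eq_letter hα h0 h1, e, letter_add_int, charWord]
      · intro z hz
        rw [e] at hz
        refine hne (z - k) 0 ?_
        push_cast at hz ⊢
        linarith
      · intro z hz
        rw [e] at hz
        refine hne (z - k) 1 ?_
        push_cast at hz ⊢
        linarith
    · rw [IsAdd, hσ, zero_word hα h0 h1]

/-! ### Complements -/

theorem psi_of_lt (α : ℝ) (n d k : ℕ) (hk : k < continuant α (n + d)) :
    psi α n (d + 1) k = psi α n d k := by
  rw [psi, Nat.mod_eq_of_lt hk]

/-- As `q_{n+d+2} ≡ q_{n+d}` modulo `q_{n+d+1}`, two reductions lower `d` by 2; the parity of `d`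
decides the outcome. -/
theorem psi_continuant_sub (α : ℝ) (n r d : ℕ) (hr : r + 2 ≤ continuant α n) :
    psi α n d (continuant α (n + d) - 2 - r) = continuant α n - 2 - r ∨
      psi α n d (continuant α (n + d) - 2 - r) =
        (continuant α (n + 1) - 2 - r) % continuant α n := by
  induction d using Nat.strong_induction_on with
  | _ d ih =>
    match d with
    | 0 => exact Or.inl rfl
    | 1 => exact Or.inr rfl
    | d + 2 =>
      have hle := continuant_mono α (Nat.le_add_right n d)
      have hlt := continuant_le_succ α (n + d)
      have e : psi α n (d + 2) (continuant α (n + (d + 2)) - 2 - r) =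
          psi α n d (continuant α (n + d) - 2 - r) := by
        have e1 : continuant α (n + (d + 2)) - 2 - r =
            partQuot α (n + d + 2) * continuant α (n + d + 1) +
              (continuant α (n + d) - 2 - r) := by
          rw [show n + (d + 2) = n + d + 2 by omega, continuant_rec]
          omega
        rw [psi, e1, show n + (d + 1) = n + d + 1 by omega, Nat.mul_add_mod',
          Nat.mod_eq_of_lt (by omega), psi_of_lt _ _ _ _ (by omega)]
      rw [e]
      exact ih d (by omega)

theorem AlphaNumber.supp_nonempty {ρ : AlphaNumber α} (hρ : Tendsto ρ.comp atTop atTop) (n : ℕ) :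
    (ρ.supp ∩ Set.Ici n).Nonempty := by
  by_contra hcon
  have hd : ∀ k, n ≤ k → ρ.digit k = 0 := fun k hk => by
    by_contra hne
    exact hcon ⟨k, hne, hk⟩
  have hc : ∀ k, ρ.comp (n + k) = ρ.comp n := by
    intro k
    induction k with
    | zero => rfl
    | succ k ih => rw [← add_assoc, ρ.comp_succ, hd _ (by omega), ih]; simp
  obtain ⟨m, hm, hm'⟩ := ((hρ.eventually_gt_atTop (ρ.comp n)).and (eventually_ge_atTop n)).exists
  obtain ⟨k, rfl⟩ := Nat.exists_eq_add_of_le hm'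
  rw [hc] at hm
  omega

theorem AlphaNumber.nextSupp_mem {ρ : AlphaNumber α} (hρ : Tendsto ρ.comp atTop atTop) (n : ℕ) :
    ρ.digit (ρ.nextSupp n) ≠ 0 ∧ n ≤ ρ.nextSupp n :=
  Nat.sInf_mem (ρ.supp_nonempty hρ n)

theorem AlphaNumber.comp_nextSupp {ρ : AlphaNumber α} (hρ : Tendsto ρ.comp atTop atTop) (n : ℕ) :
    ρ.comp (ρ.nextSupp n) = ρ.comp n := by
  have key : ∀ k, n + k ≤ ρ.nextSupp n → ρ.comp (n + k) = ρ.comp n := by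
    intro k
    induction k with
    | zero => exact fun _ => rfl
    | succ k ih =>
      intro hk
      have h0 : ρ.digit (n + k) = 0 := by
        by_contra hne
        exact Nat.notMem_of_lt_sInf (show n + k < sInf (ρ.supp ∩ Set.Ici n) by
          change n + k < ρ.nextSupp n; omega) ⟨hne, by simp⟩
      rw [← add_assoc, ρ.comp_succ, h0, ih (by omega)]
      simp
  obtain ⟨k, hk⟩ := Nat.exists_eq_add_of_le (nextSupp_mem hρ n).2
  rw [hk]
  exact key k hk.ge

/-- Components are constant from `n` to `Λ = Λ_ρ(n)`, so `ρ_{Λ+1} ≡ ρ_n` modulo `q_Λ`. If `Λ > n`,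
the first reduction leaves `q_{Λ-1} - 2 - ρ_n`, which `psi_continuant_sub` handles. -/
theorem AlphaNumber.complSeq_eq {ρ : AlphaNumber α} (hρ : Tendsto ρ.comp atTop atTop) {N : ℕ}
    (hN : ∀ n, N ≤ n → ρ.comp n + 2 ≤ continuant α n) {n : ℕ} (hn : N ≤ n) :
    ρ.complSeq n = continuant α n - 2 - ρ.comp n ∨
      ρ.complSeq n = (continuant α (n + 1) - 2 - ρ.comp n) % continuant α n := by
  obtain ⟨-, hle⟩ := nextSupp_mem hρ n
  have hc := comp_nextSupp hρ n
  have hs := ρ.comp_succ (ρ.nextSupp n)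
  have hb := ρ.digit_le (ρ.nextSupp n)
  have hM := hN (ρ.nextSupp n + 1) (by omega)
  rw [complSeq]
  obtain ⟨e, he⟩ := Nat.exists_eq_add_of_le hle
  generalize ρ.nextSupp n = m at *
  subst he
  rw [show n + e + 1 - n = e + 1 by omega, psi]
  rw [hc] at hs
  rw [hs] at hM ⊢
  cases e with
  | zero =>
    right
    rw [add_zero] at *
    rw [psi]
    rw [show continuant α (n + 1) - 2 - ρ.comp n = ρ.digit n * continuant α n +
      (continuant α (n + 1) - 2 - (ρ.digit n * continuant α n + ρ.comp n)) by omega,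
      Nat.mul_add_mod']
  | succ e =>
    have hr := hN n hn
    have hle2 := continuant_mono α (Nat.le_add_right n e)
    have hlt := continuant_le_succ α (n + e)
    have e1 : continuant α (n + (e + 1) + 1) -
        2 - (ρ.digit (n + (e + 1)) * continuant α (n + (e + 1)) + ρ.comp n) =
        (partQuot α (n + e + 2) - ρ.digit (n + (e + 1))) * continuant α (n + (e + 1)) +
          (continuant α (n + e) - 2 - ρ.comp n) := by
      have hmul := Nat.mul_le_mul_right (continuant α (n + (e + 1))) hb
      rw [Nat.sub_mul]
      change continuant α (n + e + 2) - _ - _ = _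
      rw [continuant_rec]
      change _ ≤ partQuot α (n + e + 2) * continuant α (n + e + 1) at hmul
      change partQuot α (n + e + 2) * continuant α (n + e + 1) + _ - _ -
        (ρ.digit (n + e + 1) * continuant α (n + e + 1) + _) = _ * continuant α (n + e + 1) -
        ρ.digit (n + e + 1) * continuant α (n + e + 1) + _
      change ρ.digit (n + e + 1) * continuant α (n + e + 1) ≤ _ at hmul
      omega
    rw [e1, Nat.mul_add_mod', Nat.mod_eq_of_lt (by
      change _ < continuant α (n + e + 1); omega), psi_of_lt _ _ _ _ (by omega)]
    exact psi_continuant_sub α n _ e hr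

theorem AlphaNumber.complSeq_lt {ρ : AlphaNumber α} (hρ : Tendsto ρ.comp atTop atTop) {N : ℕ}
    (hN : ∀ n, N ≤ n → ρ.comp n + 2 ≤ continuant α n) {n : ℕ} (hn : N ≤ n) :
    ρ.complSeq n < continuant α n := by
  have := hN n hn
  rcases complSeq_eq hρ hN hn with h | h <;> rw [h]
  · omega
  · exact Nat.mod_lt _ (continuant_pos α n)

/-- If the digit at `n` is 0, both terms reduce the same number. If not, `ρ_{n+1} ≥ q_n`, and the
two possible values at `n + 1` differ by exactly `q_n`. -/
theorem AlphaNumber.complSeq_compat {ρ : AlphaNumber α} (hρ : Tendsto ρ.comp atTop atTop) {N : ℕ}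
    (hN : ∀ n, N ≤ n → ρ.comp n + 2 ≤ continuant α n) {n : ℕ} (hn : N ≤ n) :
    ρ.complSeq n ≡ ρ.complSeq (n + 1) [MOD continuant α n] := by
  by_cases hd : ρ.digit n = 0
  · have hset : ρ.supp ∩ Set.Ici n = ρ.supp ∩ Set.Ici (n + 1) := by
      ext k
      simp only [Set.mem_inter_iff, Set.mem_Ici, and_congr_right_iff]
      intro hk
      refine ⟨fun h => ?_, fun h => by omega⟩
      rcases h.eq_or_lt with rfl | h
      · exact absurd hd hk
      · exact h
    have hΛ : ρ.nextSupp n = ρ.nextSupp (n + 1) := by rw [nextSupp, nextSupp, hset]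
    have hle := (nextSupp_mem hρ (n + 1)).2
    rw [complSeq, complSeq, hΛ,
      show ρ.nextSupp (n + 1) + 1 - n = ρ.nextSupp (n + 1) + 1 - (n + 1) + 1 by omega, psi_succ]
    exact Nat.mod_modEq _ _
  · have hΛ : ρ.nextSupp n = n :=
      le_antisymm (Nat.sInf_le ⟨hd, Set.mem_Ici.2 le_rfl⟩) (nextSupp_mem hρ n).2
    have e : ρ.complSeq n = (continuant α (n + 1) - 2 - ρ.comp (n + 1)) % continuant α n := by
      rw [complSeq, hΛ, Nat.add_sub_cancel_left]
      rfl
    rw [e]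
    refine (Nat.mod_modEq _ _).trans ?_
    have hr := hN (n + 1) (by omega)
    have hge : continuant α n ≤ ρ.comp (n + 1) := by
      rw [ρ.comp_succ]
      have := Nat.le_mul_of_pos_left (continuant α n) (Nat.pos_of_ne_zero hd)
      omega
    rcases complSeq_eq hρ hN (show N ≤ n + 1 by omega) with h | h
    · rw [h]
    · obtain ⟨a, ha⟩ := Nat.exists_eq_add_of_lt (partQuot_pos α (n + 1))
      rw [h, continuant_rec, ha,
        show (0 + a + 1) * continuant α (n + 1) + continuant α n - 2 - ρ.comp (n + 1) =
          a * continuant α (n + 1) +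
            (continuant α n + (continuant α (n + 1) - 2 - ρ.comp (n + 1))) by
          rw [Nat.succ_mul, zero_add]; omega,
        Nat.mul_add_mod', Nat.mod_eq_of_lt (by omega)]
      exact (Nat.add_modEq_left).symm

/-- If `ρ_n = q_n - 1` infinitely often, then `ρ_n α + α` comes arbitrarily close to integers and
the angle is `-α` modulo 1. This bound keeps the natural subtractions in `complSeq` from truncating.
-/
theorem AlphaNumber.exists_comp_add_two_le (hα : Irrational α) (h0 : 0 < α) (h1 : α < 1)
    (ρ : AlphaNumber α) (hρ : ¬ InOrbit α ρ.angle) :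
    ∃ N, ∀ n, N ≤ n → ρ.comp n + 2 ≤ continuant α n := by
  rw [← eventually_atTop]
  by_contra hcon
  obtain ⟨φ, hφ, hφ'⟩ := extraction_of_frequently_atTop (not_eventually.1 hcon)
  obtain ⟨k, hk⟩ := exists_int_of_tendsto (u := fun j => ρ.approx (φ j) + α) (l := ρ.angle + α)
    (fun j => convNum α (φ j) - ρ.num (φ j))
    (((ρ.tendsto_approx hα h0 h1).comp hφ.tendsto_atTop).add_const α) (by
      refine squeeze_zero_norm (a := fun j => gap α (φ j + 1)) (fun j => ?_)
        (((tendsto_add_atTop_iff_nat 1).2 (gap_tendsto hα h0 h1)).comp hφ.tendsto_atTop)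
      have hq : ρ.comp (φ j) + 1 = continuant α (φ j) := by
        have := ρ.lt (φ j); have := hφ' j; omega
      have hq' : (ρ.comp (φ j) : ℝ) + 1 = continuant α (φ j) := by exact_mod_cast hq
      have e : ρ.approx (φ j) + α - ((convNum α (φ j) - ρ.num (φ j) : ℤ) : ℝ) =
          (-1) ^ φ j * gap α (φ j + 1) := by
        rw [← convergent_sub hα h0 h1, approx, ← hq']; push_cast; ring
      rw [e]
      simp [abs_of_pos (gap_pos hα h0 (φ j + 1))])
  exact hρ ⟨-1, k, by push_cast; linarith⟩

theorem AlphaNumber.exists_isComplement (hα : Irrational α) (h0 : 0 < α) (h1 : α < 1)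
    (ρ : AlphaNumber α) (hρ : ¬ InOrbit α ρ.angle) : ∃ σ, ρ.IsComplement σ := by
  obtain ⟨N, hN⟩ := ρ.exists_comp_add_two_le hα h0 h1 hρ
  have hu := ρ.comp_unbounded hα h0 h1 hρ
  obtain ⟨σ, hσ⟩ := AlphaNumber.exists_of_eventually α ρ.complSeq N
    (fun n hn => complSeq_lt hu hN hn) (fun n hn => complSeq_compat hu hN hn)
  exact ⟨σ, eventually_atTop.2 ⟨N, hσ⟩⟩

theorem AlphaNumber.isComplement_complement (hα : Irrational α) (h0 : 0 < α) (h1 : α < 1)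
    (ρ : AlphaNumber α) (hρ : ¬ InOrbit α ρ.angle) : ρ.IsComplement ρ.complement :=
  Classical.epsilon_spec (ρ.exists_isComplement hα h0 h1 hρ)

/-- The angles of `ρ` and of its complement add up to `-2α` modulo 1. -/
theorem AlphaNumber.IsComplement.angle_add (hα : Irrational α) (h0 : 0 < α) (h1 : α < 1)
    {ρ σ : AlphaNumber α} (h : ρ.IsComplement σ) (hρ : ¬ InOrbit α ρ.angle) :
    ∃ k : ℤ, σ.angle + ρ.angle + 2 * α = k := by
  obtain ⟨N, hN⟩ := ρ.exists_comp_add_two_le hα h0 h1 hρ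
  have hu := ρ.comp_unbounded hα h0 h1 hρ
  have hclose : ∀ᶠ n in atTop, ∃ K : ℤ,
      |((σ.comp (n + 1) + ρ.comp (n + 1) + 2 : ℕ) : ℝ) * α - K| ≤
        gap α (n + 1) + gap α (n + 2) := by
    filter_upwards [(tendsto_add_atTop_nat 1).eventually h, eventually_ge_atTop N] with n hn hnN
    have hr := hN (n + 1) (by omega)
    have c0 := convergent_sub hα h0 h1 n
    have c1 := convergent_sub hα h0 h1 (n + 1)
    have g1 := gap_pos hα h0 (n + 1)
    have g2 := gap_pos hα h0 (n + 2)
    have a0 : |(continuant α n : ℝ) * α - convNum α n| = gap α (n + 1) := by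
      rw [c0]; simp [abs_of_pos g1]
    have a1 : |(continuant α (n + 1) : ℝ) * α - convNum α (n + 1)| = gap α (n + 2) := by
      rw [c1]; simp [abs_of_pos g2]
    rw [hn]
    rcases complSeq_eq hu hN (show N ≤ n + 1 by omega) with hc | hc
    · refine ⟨convNum α (n + 1), ?_⟩
      rw [hc, show continuant α (n + 1) - 2 - ρ.comp (n + 1) + ρ.comp (n + 1) + 2 =
        continuant α (n + 1) by omega, Int.cast_natCast, a1]
      linarith
    · have hs := Nat.mod_lt (continuant α (n + 1 + 1) - 2 - ρ.comp (n + 1))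
        (continuant_pos α (n + 1))
      have hdiv := Nat.div_add_mod' (continuant α (n + 1 + 1) - 2 - ρ.comp (n + 1))
        (continuant α (n + 1))
      rw [← hc] at hs hdiv
      generalize (continuant α (n + 1 + 1) - 2 - ρ.comp (n + 1)) / continuant α (n + 1) = D at hdiv
      have hle := continuant_le_succ α n
      have hle' := continuant_le_succ α (n + 1)
      have hrec : continuant α (n + 1 + 1) = _ := continuant_rec α n
      have e : ((ρ.complSeq (n + 1) + ρ.comp (n + 1) + 2 : ℕ) : ℤ) =
          continuant α n + (partQuot α (n + 2) - D) * continuant α (n + 1) := by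
        have : D * continuant α (n + 1) + (ρ.complSeq (n + 1) + ρ.comp (n + 1) + 2) =
          partQuot α (n + 2) * continuant α (n + 1) + continuant α n := by omega
        have : (D : ℤ) * continuant α (n + 1) +
            ((ρ.complSeq (n + 1) + ρ.comp (n + 1) + 2 : ℕ) : ℤ) =
          partQuot α (n + 2) * continuant α (n + 1) + continuant α n := by exact_mod_cast this
        linear_combination this
      generalize (partQuot α (n + 2) - D : ℤ) = j at e
      have hq : (0 : ℤ) < continuant α (n + 1) := by exact_mod_cast continuant_pos α (n + 1)
      have hq0 : (0 : ℤ) < continuant α n := by exact_mod_cast continuant_pos α n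
      have hj1 : j ≤ 1 := by
        by_contra hcj
        have : (2 : ℤ) * continuant α (n + 1) ≤ j * continuant α (n + 1) :=
          mul_le_mul_of_nonneg_right (by omega) hq.le
        omega
      have hj0 : 0 ≤ j := by
        by_contra hcj
        have : j * continuant α (n + 1) ≤ -1 * (continuant α (n + 1) : ℤ) :=
          mul_le_mul_of_nonneg_right (by omega) hq.le
        omega
      -- So `σ_{n+1} + ρ_{n+1} + 2` is `q_n` or `q_n + q_{n+1}` in this case.
      have hj : j = 0 ∨ j = 1 := by omega
      rcases hj with rfl | rfl
      · refine ⟨convNum α n, ?_⟩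
        rw [show ρ.complSeq (n + 1) + ρ.comp (n + 1) + 2 = continuant α n by omega,
          Int.cast_natCast, a0]
        linarith
      · refine ⟨convNum α n + convNum α (n + 1), ?_⟩
        rw [show ρ.complSeq (n + 1) + ρ.comp (n + 1) + 2 =
          continuant α n + continuant α (n + 1) by omega]
        push_cast
        rw [show ((continuant α n : ℝ) + continuant α (n + 1)) * α -
          (convNum α n + convNum α (n + 1)) = (continuant α n * α - convNum α n) +
          (continuant α (n + 1) * α - convNum α (n + 1)) by ring, ← a0, ← a1]
        exact abs_add_le _ _
  obtain ⟨M, hM⟩ := eventually_atTop.1 hclose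
  choose! K hK using hM
  have hlim := (tendsto_add_atTop_iff_nat 1).2
    (((σ.tendsto_approx hα h0 h1).add (ρ.tendsto_approx hα h0 h1)).add_const (2 * α))
  refine exists_int_of_tendsto (fun n => K n - σ.num (n + 1) - ρ.num (n + 1)) hlim ?_
  refine squeeze_zero_norm' (a := fun n => gap α (n + 1) + gap α (n + 2)) ?_ ?_
  · filter_upwards [eventually_ge_atTop M] with n hn
    refine le_of_eq_of_le ?_ (hK n hn)
    rw [Real.norm_eq_abs, approx, approx]
    congr 1
    push_cast
    ring
  · simpa using ((tendsto_add_atTop_iff_nat 1).2 (gap_tendsto hα h0 h1)).add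
      ((tendsto_add_atTop_iff_nat 2).2 (gap_tendsto hα h0 h1))

theorem AlphaNumber.IsComplement.angle_eq (hα : Irrational α) (h0 : 0 < α) (h1 : α < 1)
    {ρ σ : AlphaNumber α} (h : ρ.IsComplement σ) (hρ : ¬ InOrbit α ρ.angle) :
    ∃ k : ℤ, σ.angle = -ρ.angle - 2 * α + k := by
  obtain ⟨k, hk⟩ := h.angle_add hα h0 h1 hρ
  exact ⟨k, by linarith⟩

theorem AlphaNumber.IsComplement.not_inOrbit (hα : Irrational α) (h0 : 0 < α) (h1 : α < 1)
    {ρ σ : AlphaNumber α} (h : ρ.IsComplement σ) (hρ : ¬ InOrbit α ρ.angle) :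
    ¬ InOrbit α σ.angle := by
  rintro ⟨m, l, hm⟩
  obtain ⟨k, hk⟩ := h.angle_eq hα h0 h1 hρ
  exact hρ ⟨-m - 2, k - l, by push_cast; linarith⟩

/-- Reflection of the rotation that exchanges `ρ` and its complement. -/
theorem letter_reflect_angle {b : ℝ} (hb : ¬ InOrbit α b) (m k : ℤ) :
    letter α (-b - 2 * α + k - m * α) = letter α (b + (m + 1) * α) := by
  rw [show -b - 2 * α + k - m * α = -(b + (m + 1) * α) - α + k by ring, letter_add_int,
    letter_reflect]
  · exact_mod_cast not_int_of_not_inOrbit hb (m + 1)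
  · intro z
    have := not_int_of_not_inOrbit hb (m + 2) z
    push_cast at this
    convert this using 1
    ring

theorem AlphaNumber.IsComplement.word_eq_infProd (hα : Irrational α) (h0 : 0 < α) (h1 : α < 1)
    {ρ σ : AlphaNumber α} (h : ρ.IsComplement σ) (hρ : ¬ InOrbit α ρ.angle) :
    ρ.word = σ.infProd := by
  funext i
  obtain ⟨k, hk⟩ := h.angle_eq hα h0 h1 hρ
  rw [ρ.word_eq_letter_of_not_inOrbit hα h0 h1 hρ,
    σ.infProd_eq_letter hα h0 h1 (h.not_inOrbit hα h0 h1 hρ), hk]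
  exact_mod_cast (letter_reflect_angle hρ i k).symm

/-- By the reflection both halves code one two-sided orbit, that of the angle of `ρ`; each tail is
then a rotation word. -/
theorem AlphaNumber.IsComplement.isSturmianOrbit (hα : Irrational α) (h0 : 0 < α) (h1 : α < 1)
    {ρ σ : AlphaNumber α} (h : ρ.IsComplement σ) (hρ : ¬ InOrbit α ρ.angle) :
    IsSturmianOrbit α (biInfinite σ.word ρ.word) := by
  obtain ⟨k, hk⟩ := h.angle_eq hα h0 h1 hρ
  have key : ∀ z : ℤ, biInfinite σ.word ρ.word z = letter α (ρ.angle + (z + 1) * α) := by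
    intro z
    cases z with
    | ofNat n =>
      rw [biInfinite, ρ.word_eq_letter_of_not_inOrbit hα h0 h1 hρ]
      simp
    | negSucc n =>
      rw [biInfinite, σ.word_eq_letter_of_not_inOrbit hα h0 h1 (h.not_inOrbit hα h0 h1 hρ), hk,
        ← letter_reflect_angle hρ _ k]
      congr 1
      push_cast
      ring
  intro z
  refine LowDiscrepancy.isSturmianOfSlope hα h0 h1
    (lowDiscrepancy_of_letter h0 h1 (t := ρ.angle + (z + 1) * α) fun n => ?_)
  rw [key]
  congr 1
  push_cast
  ring

theorem AlphaNumber.infProd_injective (hα : Irrational α) (h0 : 0 < α) (h1 : α < 1)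
    {ρ σ : AlphaNumber α} (hρ : ¬ InOrbit α ρ.angle) (hσ : ¬ InOrbit α σ.angle)
    (h : ρ.infProd = σ.infProd) : ρ = σ := by
  obtain ⟨k, hk⟩ := exists_int_of_letter_eq_neg hα h0 h1 (s := ρ.angle) (t := σ.angle)
    fun i => by
      rw [← ρ.infProd_eq_letter hα h0 h1 hρ, h, σ.infProd_eq_letter hα h0 h1 hσ]
  exact AlphaNumber.eq_of_angle_sub_int hα h0 h1 hρ hk

end Sturm

/-! ### The main theorem -/

open Sturm
theorem mainTheorem3 (α : ℝ) (hα : Irrational α) (hα0 : 0 < α) (hα1 : α < 1) :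
    (∀ ρ : AlphaNumber α, ρ.NonzeroClass →
      -- the complement is given asymptotically by its defining sequence
      ρ.IsComplement ρ.complement ∧
      -- the complement map is an involution of the set of α-numbers with non-zero class
      ρ.complement.NonzeroClass ∧
      ρ.complement.complement = ρ ∧
      -- the limit that defines the word of formal intercept ρ exists
      Tendsto (fun n => shift^[ρ.comp n] (characteristicWord α)) atTop (𝓝 ρ.word) ∧
      -- the product attached to the complement is infinite, and equal to this word
      Tendsto (fun N => (ρ.complement.finProd N).length) atTop atTop ∧
      ρ.word = ρ.complement.infProd ∧
      IsSturmianOrbit α (biInfinite ρ.complement.word ρ.word)) ∧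
    (∀ x : Word, IsSturmianOfSlope α x → ¬ WordHasZeroClass α x →
      ∃! ρ : AlphaNumber α, ρ.NonzeroClass ∧ x = ρ.infProd) := by
  constructor
  · intro ρ hρ
    rw [ρ.nonzeroClass_iff hα hα0 hα1] at hρ
    have hc := ρ.isComplement_complement hα hα0 hα1 hρ
    have hσ := hc.not_inOrbit hα hα0 hα1 hρ
    have hcc := ρ.complement.isComplement_complement hα hα0 hα1 hσ
    refine ⟨hc, (AlphaNumber.nonzeroClass_iff hα hα0 hα1 _).2 hσ, ?_,
      ρ.tendsto_word hα hα0 hα1, ?_, hc.word_eq_infProd hα hα0 hα1 hρ,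
      hc.isSturmianOrbit hα hα0 hα1 hρ⟩
    -- The map `t ↦ -t - 2α` is an involution, so the double complement has the angle of `ρ` modulo
    -- 1.
    · obtain ⟨k, hk⟩ := hc.angle_eq hα hα0 hα1 hρ
      obtain ⟨l, hl⟩ := hcc.angle_eq hα hα0 hα1 hσ
      exact AlphaNumber.eq_of_angle_sub_int hα hα0 hα1 (hcc.not_inOrbit hα hα0 hα1 hσ)
        (k := l - k) (by push_cast; linarith)
    · simp_rw [AlphaNumber.length_finProd hα hα0 hα1]
      exact ρ.complement.comp_unbounded hα hα0 hα1 hσ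
  · intro x hx hz
    obtain ⟨ρ, rfl⟩ := (hx.lowDiscrepancy hα).exists_word_eq hα hα0 hα1
    have hρ : ¬ InOrbit α ρ.angle :=
      (ρ.nonzeroClass_iff hα hα0 hα1).1 fun he => hz ⟨ρ, rfl, he⟩
    have hc := ρ.isComplement_complement hα hα0 hα1 hρ
    have hσ := hc.not_inOrbit hα hα0 hα1 hρ
    have hw := hc.word_eq_infProd hα hα0 hα1 hρ
    -- With `ρ` a formal intercept of the word, `ρ.complement` is the required `α`-number by part
    -- (1).
    refine ⟨ρ.complement, ⟨(AlphaNumber.nonzeroClass_iff hα hα0 hα1 _).2 hσ, hw⟩, ?_⟩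
    rintro τ ⟨hτ, hτw⟩
    exact AlphaNumber.infProd_injective hα hα0 hα1
      ((τ.nonzeroClass_iff hα hα0 hα1).1 hτ) hσ (hτw.symm.trans hw)
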